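/- Let $q$ be an indeterminate. A composition is a finite sequence $\lambda=(\lambda_1,\dots,\lambda_\ell)$ of non-negative integers (zero parts and length $\ell=\ell(\lambda)=0$ are allowed, and sequences of different lengths are different); write $|\lambda|=\lambda_1+\cdots+\lambda_\ell$, and let $\mathrm{Mat}(\lambda,\mu)$ be the set of $\ell(\lambda)\times\ell(\mu)$ matrices of non-negative integers whose $i$th row sums to $\lambda_i$ and whose $j$th column sums to $\mu_j$ for all $i,j$ (so it is empty if $|\lambda|\neq|\mu|$). Let $\mathcal O_q(n)$ be the $\mathbb Z[q,q^{-1}]$-algebra with generators $x_{i,j}$ ($1\le i,j\le n$) and relations $$x_{i,j}x_{k,l}=\begin{cases}x_{k,l}x_{i,j}&\text{if } i<k,\ j>l,\\ x_{k,l}x_{i,j}-(q-q^{-1})x_{i,l}x_{k,j}&\text{if } i>k,\ j>l,\\ q^{-1}x_{k,l}x_{i,j}&\text{if } i=k,\ j>l,\\ q\,x_{k,l}x_{i,j}&\text{if } i<k,\ j=l,\end{cases}$$ with comultiplication the algebra homomorphism $\Delta:\mathcal O_q(n)\to\mathcal O_q(n)\otimes\mathcal O_q(n)$ given by $\Delta(x_{i,k})=\sum_{j}x_{i,j}\otimes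 x_{j,k}$. For an $n\times n$ matrix $A=(a_{i,j})$ of non-negative integers, let $x_A$ be the product of the $x_{i,j}^{a_{i,j}}$ ordered so that the column index $j$ increases from left to right and, for equal $j$, the row index $i$ decreases from left to right. **Theorem.** For every $n\ge 0$ the elements $x_A$ form a basis of $\mathcal O_q(n)$ over $\mathbb Z[q,q^{-1}]$. Let $\{\xi_A\}$ be the dual functions, $\langle\xi_A,x_B\rangle=\delta_{A,B}$, and put $Z(A,B,C):=\langle\xi_A\otimes\xi_B,\Delta(x_C)\rangle\in\mathbb Z[q,q^{-1}]$ for $n\times n$ matrices $A,B,C$. There is a $\mathbb Z[q,q^{-1}]$-linear strict monoidal category $q\text{-}\mathbf{Schur}$ such that: 1. the objects are all compositions; 2. $\operatorname{Hom}(\mu,\lambda)$ is a free $\mathbb Z[q,q^{-1}]$-module with a basis $\{\xi_A : A\in\mathrm{Mat}(\lambda,\mu)\}$; in particular it is $0$ unless $|\lambda|=|\mu|$; 3. the tensor product of objects is concatenation of compositions; 4. the tensor product of morphisms is given by $\xi_A\star\xi_B=\xi_{\operatorname{diag}(A,B)}$; 5. the composition of morphisms is given, for $A\in\mathrm{Mat}(\lambda,\mu)$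 and $B\in\mathrm{Mat}(\mu,\nu)$, by $$\xi_A\circ\xi_B=\sum_{C\in\mathrm{Mat}(\lambda,\nu)}Z(A,B,C)\,\xi_C .$$ Here, if $\lambda,\mu,\nu$ do not all have the same length, $Z(A,B,C)$ means $Z(A',B',C')$, where one chooses any $n\ge\ell(\lambda),\ell(\mu),\ell(\nu)$, inserts zero parts (in any positions) into $\lambda,\mu,\nu$ to get compositions of length $n$, and lets $A',B',C'$ be the $n\times n$ matrices obtained from $A,B,C$ by inserting the corresponding rows and columns of zeros; the formula holds for every such choice; 6. the unit object is the composition of length zero, and the identity endomorphism of $\lambda$ is $\xi_{\operatorname{diag}(\lambda_1,\dots,\lambda_{\ell(\lambda)})}$. -/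

import Mathlib

open CategoryTheory MonoidalCategory
open scoped TensorProduct LaurentPolynomial

namespace QSchur

/-! ### The ground ring `ℤ[q, q⁻¹]` -/

/-- The ring `ℤ[q, q⁻¹]` of Laurent polynomials. -/
abbrev Zq : Type := ℤ[T;T⁻¹]

/-- The indeterminate `q`. -/
noncomputable def q : Zq := LaurentPolynomial.T 1

/-- The inverse `q⁻¹`. -/
noncomputable def qInv : Zq := LaurentPolynomial.T (-1)

theorem q_mul_qInv : q * qInv = 1 := by
  rw [q, qInv, ← LaurentPolynomial.T_add]; simp

/-! ### Manin's quantized coordinate algebra of `n × n` matrices -/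

/-- The defining relations of the quantized coordinate algebra, between elements of the free
algebra on generators `x_{i,j}`. -/
inductive ManinRel (n : ℕ) :
    FreeAlgebra Zq (Fin n × Fin n) → FreeAlgebra Zq (Fin n × Fin n) → Prop
  | comm (i j k l : Fin n) (h : i < k) (h' : l < j) :
      ManinRel n
        (FreeAlgebra.ι Zq (i, j) * FreeAlgebra.ι Zq (k, l))
        (FreeAlgebra.ι Zq (k, l) * FreeAlgebra.ι Zq (i, j))
  | cross (i j k l : Fin n) (h : k < i) (h' : l < j) :
      ManinRel n
        (FreeAlgebra.ι Zq (i, j) * FreeAlgebra.ι Zq (k, l))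
        (FreeAlgebra.ι Zq (k, l) * FreeAlgebra.ι Zq (i, j)
          - (q - qInv) • (FreeAlgebra.ι Zq (i, l) * FreeAlgebra.ι Zq (k, j)))
  | row (i j l : Fin n) (h' : l < j) :
      ManinRel n
        (FreeAlgebra.ι Zq (i, j) * FreeAlgebra.ι Zq (i, l))
        (qInv • (FreeAlgebra.ι Zq (i, l) * FreeAlgebra.ι Zq (i, j)))
  | col (i j k : Fin n) (h : i < k) :
      ManinRel n
        (FreeAlgebra.ι Zq (i, j) * FreeAlgebra.ι Zq (k, j))
        (q • (FreeAlgebra.ι Zq (k, j) * FreeAlgebra.ι Zq (i, j)))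

/-- The quantized coordinate algebra `O_q(n)`. -/
def Oq (n : ℕ) : Type := RingQuot (ManinRel n)

noncomputable instance (n : ℕ) : Ring (Oq n) := inferInstanceAs (Ring (RingQuot (ManinRel n)))

noncomputable instance (n : ℕ) : Algebra Zq (Oq n) :=
  inferInstanceAs (Algebra Zq (RingQuot (ManinRel n)))

/-- The quotient map from the free algebra. -/
noncomputable def Oq.mk (n : ℕ) : FreeAlgebra Zq (Fin n × Fin n) →ₐ[Zq] Oq n :=
  RingQuot.mkAlgHom Zq (ManinRel n)

theorem Oq.mk_rel {n : ℕ} {a b : FreeAlgebra Zq (Fin n × Fin n)} (h : ManinRel n a b) :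
    Oq.mk n a = Oq.mk n b :=
  RingQuot.mkAlgHom_rel Zq h

/-- The generator `x_{i,j}` of `O_q(n)`. -/
noncomputable def gen {n : ℕ} (i j : Fin n) : Oq n :=
  Oq.mk n (FreeAlgebra.ι Zq (i, j))

theorem gen_comm {n : ℕ} {i j k l : Fin n} (h : i < k) (h' : l < j) :
    gen i j * gen k l = gen k l * gen i j := by
  simpa only [gen, map_mul] using Oq.mk_rel (ManinRel.comm i j k l h h')

theorem gen_cross {n : ℕ} {i j k l : Fin n} (h : k < i) (h' : l < j) :
    gen i j * gen k l = gen k l * gen i j - (q - qInv) • (gen i l * gen k j) := by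
  simpa only [gen, map_mul, map_sub, map_smul] using
    Oq.mk_rel (ManinRel.cross i j k l h h')

theorem gen_row {n : ℕ} (i : Fin n) {j l : Fin n} (h' : l < j) :
    gen i j * gen i l = qInv • (gen i l * gen i j) := by
  simpa only [gen, map_mul, map_smul] using
    Oq.mk_rel (ManinRel.row i j l h')

theorem gen_col {n : ℕ} {i k : Fin n} (j : Fin n) (h : i < k) :
    gen i j * gen k j = q • (gen k j * gen i j) := by
  simpa only [gen, map_mul, map_smul] using
    Oq.mk_rel (ManinRel.col i j k h)

/-- The value `∑ j, x_{i,j} ⊗ x_{j,k}` of the comultiplication on `x_{i,k}`. -/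
noncomputable def comulGen {n : ℕ} (i k : Fin n) : Oq n ⊗[Zq] Oq n :=
  ∑ j : Fin n, gen i j ⊗ₜ[Zq] gen j k

theorem comulGen_mul {n : ℕ} (i j k l : Fin n) :
    comulGen i j * comulGen k l =
      ∑ a : Fin n, ∑ b : Fin n, (gen i a * gen k b) ⊗ₜ[Zq] (gen a j * gen b l) := by
  simp only [comulGen, Finset.sum_mul_sum, Algebra.TensorProduct.tmul_mul_tmul]

theorem sum_sum_eq_of_pairs {n : ℕ} {M : Type*} [AddCommGroup M] (F G : Fin n → Fin n → M)
    (hd : ∀ a, F a a = G a a) (hp : ∀ a b, a < b → F a b + F b a = G a b + G b a) :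
    ∑ a, ∑ b, F a b = ∑ a, ∑ b, G a b := by
  have key : ∀ H : Fin n → Fin n → M, ∑ a, ∑ b, H a b =
      ∑ a, H a a + ∑ a, ∑ b, if a < b then H a b + H b a else 0 := by
    intro H
    have h1 : ∑ a, ∑ b, H a b = ∑ a, ∑ b, ((if a = b then H a b else 0) +
        ((if a < b then H a b else 0) + (if b < a then H a b else 0))) := by
      refine Finset.sum_congr rfl fun a _ => Finset.sum_congr rfl fun b _ => ?_
      rcases lt_trichotomy a b with h | h | h
      · simp [h, h.ne, h.not_gt]
      · simp [h]
      · simp [h, h.ne', h.not_gt]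
    rw [h1]
    simp only [Finset.sum_add_distrib]
    congr 1
    · simp
    · rw [Finset.sum_comm (f := fun a b => if b < a then H a b else 0),
        ← Finset.sum_add_distrib]
      refine Finset.sum_congr rfl fun a _ => ?_
      rw [← Finset.sum_add_distrib]
      refine Finset.sum_congr rfl fun b _ => ?_
      split_ifs <;> simp
  rw [key F, key G]
  congr 1
  · exact Finset.sum_congr rfl fun a _ => hd a
  · refine Finset.sum_congr rfl fun a _ => Finset.sum_congr rfl fun b _ => ?_
    split_ifs with h
    · exact hp a b h
    · rfl

theorem comulGen_comm {n : ℕ} {i j k l : Fin n} (h : i < k) (h' : l < j) :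
    comulGen i j * comulGen k l = comulGen k l * comulGen i j := by
  rw [comulGen_mul, comulGen_mul]
  refine sum_sum_eq_of_pairs _ _ (fun a => ?_) (fun a b hab => ?_)
  · rw [gen_col a h, gen_row a h', ← TensorProduct.smul_tmul', TensorProduct.tmul_smul,
      smul_smul, q_mul_qInv, one_smul]
  · rw [gen_comm h hab, gen_cross h hab, gen_comm hab h', gen_cross hab h']
    simp only [TensorProduct.tmul_sub, TensorProduct.sub_tmul, TensorProduct.tmul_smul,
      ← TensorProduct.smul_tmul']
    module

theorem comulGen_cross {n : ℕ} {i j k l : Fin n} (h : k < i) (h' : l < j) :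
    comulGen i j * comulGen k l =
      comulGen k l * comulGen i j - (q - qInv) • (comulGen i l * comulGen k j) := by
  rw [comulGen_mul, comulGen_mul, comulGen_mul]
  simp only [Finset.smul_sum, ← Finset.sum_sub_distrib]
  refine sum_sum_eq_of_pairs _ _ (fun a => ?_) (fun a b hab => ?_)
  · rw [gen_col a h, gen_row a h']
    simp only [TensorProduct.tmul_smul, ← TensorProduct.smul_tmul']
    module
  · rw [gen_cross h hab, gen_comm h hab, gen_comm hab h', gen_cross hab h']
    simp only [TensorProduct.tmul_sub, TensorProduct.sub_tmul, TensorProduct.tmul_smul,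
      ← TensorProduct.smul_tmul']
    module

theorem comulGen_row {n : ℕ} (i : Fin n) {j l : Fin n} (h' : l < j) :
    comulGen i j * comulGen i l = qInv • (comulGen i l * comulGen i j) := by
  rw [comulGen_mul, comulGen_mul]
  simp only [Finset.smul_sum]
  refine sum_sum_eq_of_pairs _ _ (fun a => ?_) (fun a b hab => ?_)
  · rw [gen_row a h', TensorProduct.tmul_smul]
  · rw [gen_row i hab, gen_comm hab h', gen_cross hab h']
    simp only [TensorProduct.tmul_sub, TensorProduct.tmul_smul, ← TensorProduct.smul_tmul']
    linear_combination (norm := module)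
      (-q_mul_qInv) • ((gen i a * gen i b) ⊗ₜ[Zq] (gen b l * gen a j))

theorem comulGen_col {n : ℕ} {i k : Fin n} (j : Fin n) (h : i < k) :
    comulGen i j * comulGen k j = q • (comulGen k j * comulGen i j) := by
  rw [comulGen_mul, comulGen_mul]
  simp only [Finset.smul_sum]
  refine sum_sum_eq_of_pairs _ _ (fun a => ?_) (fun a b hab => ?_)
  · rw [gen_col a h, TensorProduct.smul_tmul']
  · rw [gen_comm h hab, gen_cross h hab, gen_col j hab]
    simp only [TensorProduct.sub_tmul, TensorProduct.tmul_smul, ← TensorProduct.smul_tmul']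
    linear_combination (norm := module)
      (-q_mul_qInv) • ((gen k a * gen i b) ⊗ₜ[Zq] (gen b j * gen a j))

/-- The comultiplication `Δ : O_q(n) → O_q(n) ⊗ O_q(n)`: the algebra homomorphism such that
`Δ(x_{i,k}) = ∑ j, x_{i,j} ⊗ x_{j,k}`. -/
noncomputable def comul (n : ℕ) : Oq n →ₐ[Zq] Oq n ⊗[Zq] Oq n :=
  RingQuot.liftAlgHom Zq
    ⟨FreeAlgebra.lift Zq (fun p : Fin n × Fin n => comulGen p.1 p.2), by
      intro x y hxy
      cases hxy with
      | comm i j k l h h' => simpa using comulGen_comm h h'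
      | cross i j k l h h' => simpa using comulGen_cross h h'
      | row i j l h' => simpa using comulGen_row i h'
      | col i j k h => simpa using comulGen_col j h⟩

theorem comul_gen {n : ℕ} (i k : Fin n) :
    comul n (gen i k) = ∑ j : Fin n, gen i j ⊗ₜ[Zq] gen j k := by
  refine (RingQuot.liftAlgHom_mkAlgHom_apply _ _ _ _).trans ?_
  simp only [FreeAlgebra.lift_ι_apply, comulGen]

/-- The normally ordered monomial `x_A` of a matrix `A` of natural numbers: the product of the
`x_{i,j} ^ a_{i,j}`, with column indices `j` increasing from left to right and, for equal `j`,
row indices `i` decreasing from left to right. -/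
noncomputable def normalMonomial {n : ℕ} (A : Matrix (Fin n) (Fin n) ℕ) : Oq n :=
  ((List.finRange n).map fun j =>
    ((List.finRange n).reverse.map fun i => gen i j ^ A i j).prod).prod

/-- Given a basis `x` of `O_q(n)` indexed by matrices of natural numbers (it will be the basis
of normally ordered monomials), with dual functions `ξ_A`, the structure constant
`Z(A, B, C) = ⟨ξ_A ⊗ ξ_B, Δ(x_C)⟩`, where `⟨f ⊗ g, y ⊗ z⟩ = f(y) g(z)`. -/
noncomputable def structConst {n : ℕ} (x : Module.Basis (Matrix (Fin n) (Fin n) ℕ) Zq (Oq n))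
    (A B C : Matrix (Fin n) (Fin n) ℕ) : Zq :=
  TensorProduct.dualDistrib Zq (Oq n) (Oq n) (x.coord A ⊗ₜ[Zq] x.coord B) (comul n (x C))

/-! ### Compositions and matrices with prescribed row and column sums -/

/-- A composition: a finite sequence of natural numbers. Zero parts are allowed, and sequences
of different lengths are different. -/
@[ext]
structure Comp where
  /-- the number of parts -/
  len : ℕ
  /-- the parts -/
  part : Fin len → ℕ

namespace Comp

/-- The sum of the parts. -/
def size (lam : Comp) : ℕ := ∑ i, lam.part i

/-- The composition of length zero. -/
def empty : Comp := ⟨0, Fin.elim0⟩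

/-- Concatenation of compositions. -/
def concat (lam mu : Comp) : Comp := ⟨lam.len + mu.len, Fin.append lam.part mu.part⟩

end Comp

/-- The set `Mat(λ, μ)` of matrices of natural numbers whose rows sum to the parts of `λ` and
whose columns sum to the parts of `μ`. -/
def Mat (lam mu : Comp) : Type :=
  {A : Matrix (Fin lam.len) (Fin mu.len) ℕ //
    (∀ i, ∑ j, A i j = lam.part i) ∧ ∀ j, ∑ i, A i j = mu.part j}

namespace Mat

instance (lam mu : Comp) : Finite (Mat lam mu) := by
  let f : Mat lam mu → ∀ i : Fin lam.len, Fin mu.len → Fin (lam.part i + 1) := fun A i j =>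
    ⟨A.1 i j, Nat.lt_succ_of_le <| (A.2.1 i) ▸
      Finset.single_le_sum (f := fun j => A.1 i j) (fun _ _ => Nat.zero_le _)
        (Finset.mem_univ j)⟩
  refine Finite.of_injective f fun A B h => Subtype.ext ?_
  ext i j
  exact congrArg Fin.val (congrFun (congrFun h i) j)

noncomputable instance (lam mu : Comp) : Fintype (Mat lam mu) := Fintype.ofFinite _

/-- The diagonal matrix `diag(λ₁, …, λ_ℓ)` in `Mat(λ, λ)`. -/
def diagonal (lam : Comp) : Mat lam lam :=
  ⟨Matrix.diagonal lam.part, by simp [Matrix.diagonal_apply]⟩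

/-- The block diagonal matrix `diag(A, B)`. -/
def diag {lam mu sig rho : Comp} (A : Mat lam mu) (B : Mat sig rho) :
    Mat (lam.concat sig) (mu.concat rho) :=
  ⟨Matrix.reindex finSumFinEquiv finSumFinEquiv (Matrix.fromBlocks A.1 0 0 B.1), by
    refine ⟨fun i => ?_, fun j => ?_⟩
    · change ∑ j : Fin (mu.len + rho.len), _ = Fin.append lam.part sig.part i
      rw [← finSumFinEquiv.sum_comp]
      refine Fin.addCases (fun i => ?_) (fun i => ?_) i
      · simpa using A.2.1 i
      · simpa using B.2.1 i
    · change ∑ i : Fin (lam.len + sig.len), _ = Fin.append mu.part rho.part j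
      rw [← finSumFinEquiv.sum_comp]
      refine Fin.addCases (fun j => ?_) (fun j => ?_) j
      · simpa using A.2.2 j
      · simpa using B.2.2 j⟩

/-- The `n × n` matrix obtained from `A` by inserting rows and columns of zeros, so that the
rows and columns of `A` become those numbered by the images of the increasing maps `f`, `g`. -/
noncomputable def pad {lam mu : Comp} {n : ℕ} (f : Fin lam.len ↪o Fin n)
    (g : Fin mu.len ↪o Fin n) (A : Mat lam mu) : Matrix (Fin n) (Fin n) ℕ :=
  Matrix.of fun i j =>
    Function.extend (Prod.map f g) (Function.uncurry A.1) (fun _ => 0) (i, j)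

end Mat

end QSchur

/-! The square algebras are embedded in the family `QMat m n` of quantized coordinate algebras of
rectangular matrices, with comultiplications `QMat l n → QMat l m ⊗ QMat m n`. Functionals on these
algebras compose by convolution. Reading off a coefficient after restriction to the diagonal torus
gives functionals `weight s`. Convolution with `weight s` on the left (right) keeps the values at
normal monomials whose row (column) sums are `s` and makes the other values zero. So Hom(μ, λ) is
taken to be the space of functionals fixed by the weight of λ on the left and that of μ on the
right; the identity laws then hold by definition, and the monomial basis shows that the dual
functions of the matrices in `Mat(λ, μ)` form a basis. The tensor product is pullback along the
homomorphism that kills the generators outside two diagonal blocks.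

Each axiom is thereby dual to an equality of algebra homomorphisms, which is checked on generators,
so no formula for the structure constants is needed: `comul_coassoc` gives associativity of
composition, `comul_blockProj` the interchange law, `blockProj_assoc` the associativity of the
tensor product, and `retract_comul_embed` the independence of the inserted zeros.

The monomial basis is proved for all `m × n`. Spanning is straightening, within a column and then
between columns. Independence is by induction on the number of columns: `QMat m (1 + n)` acts on the
tensor product of the free module on `ℤ^m` with `QMat m n`, in such a way that `x_A` sends `e_0 ⊗ 1`
to `e_v ⊗ x_{A'}`, where `v` is the first column of `A` and `A'` is the rest. The action comes from
a product of two quantum matrices with entries in different tensor factors (`IsManin.tmul`); the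
computation lies in `isManin_columnOp`. -/

namespace QSchur

/-! ### Ordered products over `Fin n` -/

section OrderedProducts

variable {B : Type*} [Monoid B]

theorem finRange_add (a b : ℕ) : List.finRange (a + b) =
    (List.finRange a).map (Fin.castAdd b) ++ (List.finRange b).map (Fin.natAdd a) := by
  simp only [← List.ofFn_id, List.ofFn_add, List.map_ofFn]
  rfl

theorem prod_map_finRange_add {a b : ℕ} (F : Fin (a + b) → B) :
    ((List.finRange (a + b)).map F).prod =
      ((List.finRange a).map fun i => F (Fin.castAdd b i)).prod *
        ((List.finRange b).map fun i => F (Fin.natAdd a i)).prod := by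
  rw [finRange_add, List.map_append, List.prod_append, List.map_map, List.map_map]
  rfl

theorem prod_map_reverse_finRange_add {a b : ℕ} (F : Fin (a + b) → B) :
    ((List.finRange (a + b)).reverse.map F).prod =
      ((List.finRange b).reverse.map fun i => F (Fin.natAdd a i)).prod *
        ((List.finRange a).reverse.map fun i => F (Fin.castAdd b i)).prod := by
  rw [finRange_add, List.reverse_append, List.map_append, List.prod_append, ← List.map_reverse,
    ← List.map_reverse, List.map_map, List.map_map]
  rfl

theorem prod_map_filter_of_eq_one {α : Type*} (l : List α) (p : α → Bool) (F : α → B)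
    (h : ∀ x, ¬ p x → F x = 1) : (l.map F).prod = ((l.filter p).map F).prod := by
  induction l with
  | nil => rfl
  | cons x l ih =>
    by_cases hx : p x
    · simp [hx, ih]
    · simp [hx, ih, h x hx]

-- Both lists are strictly increasing and have the same members.
open Classical in
theorem filter_finRange_range {a n : ℕ} (f : Fin a ↪o Fin n) :
    (List.finRange n).filter (· ∈ Set.range f) = (List.finRange a).map f := by
  refine List.SortedLT.eq_of_mem_iff ?_ ?_ ?_
  · exact ((List.pairwise_lt_finRange n).filter _).sortedLT
  · exact ((List.pairwise_lt_finRange a).map f fun x y h => f.strictMono h).sortedLT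
  · intro k
    simp

theorem prod_map_finRange_embedding {a n : ℕ} (f : Fin a ↪o Fin n) (F : Fin n → B)
    (h : ∀ k, k ∉ Set.range f → F k = 1) :
    ((List.finRange n).map F).prod = ((List.finRange a).map fun i => F (f i)).prod := by
  classical
  rw [prod_map_filter_of_eq_one _ (· ∈ Set.range f) F fun k hk => h k (by simpa using hk),
    filter_finRange_range, List.map_map]
  rfl

theorem prod_map_reverse_finRange_embedding {a n : ℕ} (f : Fin a ↪o Fin n) (F : Fin n → B)
    (h : ∀ k, k ∉ Set.range f → F k = 1) :
    ((List.finRange n).reverse.map F).prod =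
      ((List.finRange a).reverse.map fun i => F (f i)).prod := by
  classical
  rw [prod_map_filter_of_eq_one _ (· ∈ Set.range f) F fun k hk => h k (by simpa using hk),
    List.filter_reverse, filter_finRange_range, ← List.map_reverse, List.map_map]
  rfl

theorem prod_map_eq_one {α : Type*} (l : List α) (F : α → B) (h : ∀ x, F x = 1) :
    (l.map F).prod = 1 := by
  simp [funext h]

end OrderedProducts

/-! ### Normally ordered monomials in the entries of a matrix -/

/-- The normally ordered monomial in the entries of `M` with exponents `A`. -/
def monomial {m n : ℕ} {B : Type*} [Monoid B] (M : Matrix (Fin m) (Fin n) B)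
    (A : Matrix (Fin m) (Fin n) ℕ) : B :=
  ((List.finRange n).map fun j =>
    ((List.finRange m).reverse.map fun i => M i j ^ A i j).prod).prod

/-- The block diagonal matrix `diag(M, N)`. -/
def blockDiag {a b c d : ℕ} {B : Type*} [Zero B] (M : Matrix (Fin a) (Fin c) B)
    (N : Matrix (Fin b) (Fin d) B) : Matrix (Fin (a + b)) (Fin (c + d)) B :=
  Matrix.reindex finSumFinEquiv finSumFinEquiv (Matrix.fromBlocks M 0 0 N)

section BlockDiag

variable {a b c d : ℕ} {B : Type*} [Zero B] (M : Matrix (Fin a) (Fin c) B)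
    (N : Matrix (Fin b) (Fin d) B)

@[simp]
theorem blockDiag_castAdd_castAdd (i : Fin a) (j : Fin c) :
    blockDiag M N (Fin.castAdd b i) (Fin.castAdd d j) = M i j := by
  simp [blockDiag]

@[simp]
theorem blockDiag_castAdd_natAdd (i : Fin a) (j : Fin d) :
    blockDiag M N (Fin.castAdd b i) (Fin.natAdd c j) = 0 := by
  simp [blockDiag]

@[simp]
theorem blockDiag_natAdd_castAdd (i : Fin b) (j : Fin c) :
    blockDiag M N (Fin.natAdd a i) (Fin.castAdd d j) = 0 := by
  simp [blockDiag]

@[simp]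
theorem blockDiag_natAdd_natAdd (i : Fin b) (j : Fin d) :
    blockDiag M N (Fin.natAdd a i) (Fin.natAdd c j) = N i j := by
  simp [blockDiag]

theorem eq_blockDiag_of_eq_zero (E : Matrix (Fin (a + b)) (Fin (c + d)) B)
    (h₁ : ∀ i j, E (Fin.castAdd b i) (Fin.natAdd c j) = 0)
    (h₂ : ∀ i j, E (Fin.natAdd a i) (Fin.castAdd d j) = 0) :
    E = blockDiag (E.submatrix (Fin.castAdd b) (Fin.castAdd d))
      (E.submatrix (Fin.natAdd a) (Fin.natAdd c)) := by
  ext i j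
  induction i using Fin.addCases <;> induction j using Fin.addCases <;> simp [h₁, h₂]

theorem blockDiag_inj {M M' : Matrix (Fin a) (Fin c) B} {N N' : Matrix (Fin b) (Fin d) B} :
    blockDiag M N = blockDiag M' N' ↔ M = M' ∧ N = N' := by
  refine ⟨fun h => ⟨?_, ?_⟩, fun h => by rw [h.1, h.2]⟩
  · ext i j
    simpa using congrFun (congrFun h (Fin.castAdd b i)) (Fin.castAdd d j)
  · ext i j
    simpa using congrFun (congrFun h (Fin.natAdd a i)) (Fin.natAdd c j)

end BlockDiag

/-- The matrix with entries `M i j` in the rows and columns numbered by the images of `f` and `g`,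
and zeros elsewhere. -/
noncomputable def zeroExtend {a b m n : ℕ} {B : Type*} [Zero B] (f : Fin a ↪o Fin m)
    (g : Fin b ↪o Fin n) (M : Matrix (Fin a) (Fin b) B) : Matrix (Fin m) (Fin n) B :=
  Matrix.of fun i j => Function.extend (Prod.map f g) (Function.uncurry M) (fun _ => 0) (i, j)

section ZeroExtend

variable {a b m n : ℕ} {B : Type*} [Zero B] (f : Fin a ↪o Fin m) (g : Fin b ↪o Fin n)
  (M : Matrix (Fin a) (Fin b) B)

@[simp]
theorem zeroExtend_apply (i : Fin a) (j : Fin b) : zeroExtend f g M (f i) (g j) = M i j := by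
  have h : Function.Injective (Prod.map f g) := f.injective.prodMap g.injective
  exact h.extend_apply (Function.uncurry M) (fun _ => 0) (i, j)

theorem zeroExtend_of_left {i : Fin m} (hi : i ∉ Set.range f) (j : Fin n) :
    zeroExtend f g M i j = 0 := by
  refine Function.extend_apply' (Function.uncurry M) (fun _ => 0) (i, j) ?_
  rintro ⟨⟨x, y⟩, h⟩
  exact hi ⟨x, congrArg Prod.fst h⟩

theorem zeroExtend_of_right (i : Fin m) {j : Fin n} (hj : j ∉ Set.range g) :
    zeroExtend f g M i j = 0 := by
  refine Function.extend_apply' (Function.uncurry M) (fun _ => 0) (i, j) ?_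
  rintro ⟨⟨x, y⟩, h⟩
  exact hj ⟨y, congrArg Prod.snd h⟩

theorem eq_zeroExtend_of_eq_zero (E : Matrix (Fin m) (Fin n) B)
    (h₁ : ∀ i j, i ∉ Set.range f → E i j = 0) (h₂ : ∀ i j, j ∉ Set.range g → E i j = 0) :
    E = zeroExtend f g (E.submatrix f g) := by
  ext i j
  by_cases hi : i ∈ Set.range f
  · by_cases hj : j ∈ Set.range g
    · obtain ⟨i, rfl⟩ := hi
      obtain ⟨j, rfl⟩ := hj
      simp
    · rw [h₂ i j hj, zeroExtend_of_right f g _ i hj]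
  · rw [h₁ i j hi, zeroExtend_of_left f g _ hi j]

theorem zeroExtend_injective :
    Function.Injective (zeroExtend f g : Matrix (Fin a) (Fin b) B → _) := by
  intro M M' h
  ext i j
  simpa using congrFun (congrFun h (f i)) (g j)

end ZeroExtend

/-! ### Normal monomials under homomorphisms, block decomposition, zero padding and tensor products.
-/

section Monomial

variable {m n : ℕ}

theorem map_monomial {B C F : Type*} [Monoid B] [Monoid C] [FunLike F B C] [MonoidHomClass F B C]
    (φ : F) (M : Matrix (Fin m) (Fin n) B) (A : Matrix (Fin m) (Fin n) ℕ) :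
    φ (monomial M A) = monomial (M.map φ) A := by
  simp only [monomial, Matrix.map_apply, map_list_prod, List.map_map, Function.comp_def, map_pow]

theorem monomial_eq_zero {B : Type*} [Semiring B] (M : Matrix (Fin m) (Fin n) B)
    (A : Matrix (Fin m) (Fin n) ℕ) (i : Fin m) (j : Fin n) (hM : M i j = 0) (hA : A i j ≠ 0) :
    monomial M A = 0 := by
  refine List.prod_eq_zero (List.mem_map.2 ⟨j, List.mem_finRange j, ?_⟩)
  refine List.prod_eq_zero (List.mem_map.2 ⟨i, by simp, ?_⟩)
  rw [hM, zero_pow hA]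

/-- All columns of the first block precede those of the second, and entries off the blocks have
exponent zero, so the normal order splits. -/
theorem monomial_blockDiag {a b c d : ℕ} {B : Type*} [Semiring B]
    (M : Matrix (Fin (a + b)) (Fin (c + d)) B)
    (A : Matrix (Fin a) (Fin c) ℕ) (A' : Matrix (Fin b) (Fin d) ℕ) :
    monomial M (blockDiag A A') =
      monomial (M.submatrix (Fin.castAdd b) (Fin.castAdd d)) A *
        monomial (M.submatrix (Fin.natAdd a) (Fin.natAdd c)) A' := by
  simp only [monomial, Matrix.submatrix_apply, prod_map_finRange_add, prod_map_reverse_finRange_add,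
    blockDiag_castAdd_castAdd, blockDiag_castAdd_natAdd, blockDiag_natAdd_castAdd,
    blockDiag_natAdd_natAdd, pow_zero, prod_map_eq_one _ _ fun _ => rfl, one_mul, mul_one]

theorem monomial_zeroExtend {a b : ℕ} {B : Type*} [Semiring B] (f : Fin a ↪o Fin m)
    (g : Fin b ↪o Fin n) (M : Matrix (Fin m) (Fin n) B) (A : Matrix (Fin a) (Fin b) ℕ) :
    monomial M (zeroExtend f g A) = monomial (M.submatrix f g) A := by
  unfold monomial
  rw [prod_map_finRange_embedding g]
  · congr 2
    funext j
    rw [prod_map_reverse_finRange_embedding f]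
    · simp
    · intro k hk
      rw [zeroExtend_of_left f g A hk, pow_zero]
  · intro k hk
    exact prod_map_eq_one _ _ fun i => by rw [zeroExtend_of_right f g A i hk, pow_zero]

theorem prod_map_tmul {R B C α : Type*} [CommSemiring R] [Semiring B] [Algebra R B] [Semiring C]
    [Algebra R C] (l : List α) (F : α → B) (G : α → C) :
    (l.map fun x => F x ⊗ₜ[R] G x).prod = (l.map F).prod ⊗ₜ[R] (l.map G).prod := by
  induction l with
  | nil => rfl
  | cons x l ih => simp [ih, Algebra.TensorProduct.tmul_mul_tmul]

theorem monomial_tmul {R B C : Type*} [CommSemiring R] [Semiring B] [Algebra R B] [Semiring C]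
    [Algebra R C] (M : Matrix (Fin m) (Fin n) B) (N : Matrix (Fin m) (Fin n) C)
    (A : Matrix (Fin m) (Fin n) ℕ) :
    monomial (Matrix.of fun i j => M i j ⊗ₜ[R] N i j) A = monomial M A ⊗ₜ[R] monomial N A := by
  simp only [monomial, Matrix.of_apply, Algebra.TensorProduct.tmul_pow, prod_map_tmul]

theorem monomial_eq_prod {B : Type*} [CommMonoid B] (M : Matrix (Fin m) (Fin n) B)
    (A : Matrix (Fin m) (Fin n) ℕ) : monomial M A = ∏ j, ∏ i, M i j ^ A i j := by
  simp only [monomial, List.map_reverse, List.prod_reverse, ← List.ofFn_eq_map, List.prod_ofFn]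

end Monomial

/-! ### Quantum matrices -/

/-- A matrix over a `ℤ[q, q⁻¹]`-algebra whose entries satisfy the relations of the generators of
the quantized coordinate algebra. -/
structure IsManin {m n : ℕ} {B : Type*} [Ring B] [Algebra Zq B]
    (M : Matrix (Fin m) (Fin n) B) : Prop where
  comm : ∀ {i j k l}, i < k → l < j → M i j * M k l = M k l * M i j
  cross : ∀ {i j k l}, k < i → l < j →
    M i j * M k l = M k l * M i j - (q - qInv) • (M i l * M k j)
  row : ∀ (i) {j l}, l < j → M i j * M i l = qInv • (M i l * M i j)
  col : ∀ {i k} (j), i < k → M i j * M k j = q • (M k j * M i j)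

namespace IsManin

variable {m n p : ℕ} {B C : Type*} [Ring B] [Algebra Zq B] [Ring C] [Algebra Zq C]

theorem map {M : Matrix (Fin m) (Fin n) B} (hM : IsManin M) (φ : B →ₐ[Zq] C) :
    IsManin (M.map φ) where
  comm h h' := by simp only [Matrix.map_apply, ← map_mul, hM.comm h h']
  cross h h' := by simp only [Matrix.map_apply, ← map_mul, hM.cross h h', map_sub, map_smul]
  row i _ _ h' := by simp only [Matrix.map_apply, ← map_mul, hM.row i h', map_smul]
  col j h := by simp only [Matrix.map_apply, ← map_mul, hM.col j h, map_smul]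

/-- The relations see only the relative order of the indices. -/
theorem submatrix {a b : ℕ} {M : Matrix (Fin m) (Fin n) B} (hM : IsManin M) {f : Fin a → Fin m}
    {g : Fin b → Fin n} (hf : StrictMono f) (hg : StrictMono g) :
    IsManin (M.submatrix f g) where
  comm h h' := hM.comm (hf h) (hg h')
  cross h h' := hM.cross (hf h) (hg h')
  row i _ _ h' := hM.row (f i) (hg h')
  col j h := hM.col (g j) (hf h)

/-- In each relation every term involves each of the rows and columns concerned, so an index outside
the ranges makes all terms vanish. -/
theorem zeroExtend {a b : ℕ} {M : Matrix (Fin a) (Fin b) B} (hM : IsManin M) (f : Fin a ↪o Fin m)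
    (g : Fin b ↪o Fin n) : IsManin (QSchur.zeroExtend f g M) := by
  refine ⟨fun {i j k l} h h' => ?_, fun {i j k l} h h' => ?_, fun i {j l} h' => ?_,
    fun {i k} j h => ?_⟩
  · by_cases hi : i ∈ Set.range f; swap
    · simp [zeroExtend_of_left f g M hi]
    by_cases hj : j ∈ Set.range g; swap
    · simp [zeroExtend_of_right f g M _ hj]
    by_cases hk : k ∈ Set.range f; swap
    · simp [zeroExtend_of_left f g M hk]
    by_cases hl : l ∈ Set.range g; swap
    · simp [zeroExtend_of_right f g M _ hl]
    obtain ⟨⟨i, rfl⟩, ⟨j, rfl⟩, ⟨k, rfl⟩, ⟨l, rfl⟩⟩ := And.intro hi (And.intro hj (And.intro hk hl))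
    simpa using hM.comm (f.lt_iff_lt.1 h) (g.lt_iff_lt.1 h')
  · by_cases hi : i ∈ Set.range f; swap
    · simp [zeroExtend_of_left f g M hi]
    by_cases hj : j ∈ Set.range g; swap
    · simp [zeroExtend_of_right f g M _ hj]
    by_cases hk : k ∈ Set.range f; swap
    · simp [zeroExtend_of_left f g M hk]
    by_cases hl : l ∈ Set.range g; swap
    · simp [zeroExtend_of_right f g M _ hl]
    obtain ⟨⟨i, rfl⟩, ⟨j, rfl⟩, ⟨k, rfl⟩, ⟨l, rfl⟩⟩ := And.intro hi (And.intro hj (And.intro hk hl))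
    simpa using hM.cross (f.lt_iff_lt.1 h) (g.lt_iff_lt.1 h')
  · by_cases hi : i ∈ Set.range f; swap
    · simp [zeroExtend_of_left f g M hi]
    by_cases hj : j ∈ Set.range g; swap
    · simp [zeroExtend_of_right f g M _ hj]
    by_cases hl : l ∈ Set.range g; swap
    · simp [zeroExtend_of_right f g M _ hl]
    obtain ⟨⟨i, rfl⟩, ⟨j, rfl⟩, ⟨l, rfl⟩⟩ := And.intro hi (And.intro hj hl)
    simpa using hM.row i (g.lt_iff_lt.1 h')
  · by_cases hi : i ∈ Set.range f; swap
    · simp [zeroExtend_of_left f g M hi]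
    by_cases hj : j ∈ Set.range g; swap
    · simp [zeroExtend_of_right f g M _ hj]
    by_cases hk : k ∈ Set.range f; swap
    · simp [zeroExtend_of_left f g M hk]
    obtain ⟨⟨i, rfl⟩, ⟨j, rfl⟩, ⟨k, rfl⟩⟩ := And.intro hi (And.intro hj hk)
    simpa using hM.col j (f.lt_iff_lt.1 h)

/-- A nonzero product of entries from different blocks occurs only in `cross`, and there the
correction term contains an entry off the blocks. What remains is the commutation assumed in `h`. -/
theorem blockDiag {a b c d : ℕ} {M : Matrix (Fin a) (Fin c) B} {N : Matrix (Fin b) (Fin d) B}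
    (hM : IsManin M) (hN : IsManin N) (h : ∀ i j k l, Commute (M i j) (N k l)) :
    IsManin (QSchur.blockDiag M N) where
  comm {i j k l} h₁ h₂ := by
    induction i using Fin.addCases <;> induction j using Fin.addCases <;>
      induction k using Fin.addCases <;> induction l using Fin.addCases <;>
      simp only [Fin.lt_def, Fin.val_castAdd, Fin.val_natAdd] at h₁ h₂ <;> simp <;>
      first
        | omega
        | exact hM.comm (Fin.lt_def.2 (by omega)) (Fin.lt_def.2 (by omega))
        | exact hN.comm (Fin.lt_def.2 (by omega)) (Fin.lt_def.2 (by omega))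
  cross {i j k l} h₁ h₂ := by
    induction i using Fin.addCases <;> induction j using Fin.addCases <;>
      induction k using Fin.addCases <;> induction l using Fin.addCases <;>
      simp only [Fin.lt_def, Fin.val_castAdd, Fin.val_natAdd] at h₁ h₂ <;> simp <;>
      first
        | omega
        | exact hM.cross (Fin.lt_def.2 (by omega)) (Fin.lt_def.2 (by omega))
        | exact hN.cross (Fin.lt_def.2 (by omega)) (Fin.lt_def.2 (by omega))
        | exact (h _ _ _ _).symm
  row i j l h₂ := by
    induction i using Fin.addCases <;> induction j using Fin.addCases <;>
      induction l using Fin.addCases <;>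
      simp only [Fin.lt_def, Fin.val_castAdd, Fin.val_natAdd] at h₂ <;> simp <;>
      first
        | omega
        | exact hM.row _ (Fin.lt_def.2 (by omega))
        | exact hN.row _ (Fin.lt_def.2 (by omega))
  col {i k} j h₁ := by
    induction i using Fin.addCases <;> induction j using Fin.addCases <;>
      induction k using Fin.addCases <;>
      simp only [Fin.lt_def, Fin.val_castAdd, Fin.val_natAdd] at h₁ <;> simp <;>
      first
        | omega
        | exact hM.col _ (Fin.lt_def.2 (by omega))
        | exact hN.col _ (Fin.lt_def.2 (by omega))

/-- Diagonal matrices with commuting entries satisfy the relations. -/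
theorem diagonal {B : Type*} [CommRing B] [Algebra Zq B] (s : Fin n → B) :
    IsManin (Matrix.diagonal s) where
  comm {i j k l} h h' := mul_comm _ _
  cross {i j k l} h h' := by
    -- A nonzero correction term would need `i = l` and `k = j`, which contradicts `k < i` and `l <
    -- j`.
    by_cases h₁ : i = l
    · have : k ≠ j := (h.trans (h₁ ▸ h')).ne
      simp [Matrix.diagonal_apply_ne _ this, mul_comm]
    · simp [Matrix.diagonal_apply_ne _ h₁, mul_comm]
  row i j l h' := by
    by_cases h₁ : i = l
    · have : i ≠ j := (h₁ ▸ h').ne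
      simp [Matrix.diagonal_apply_ne _ this]
    · simp [Matrix.diagonal_apply_ne _ h₁]
  col {i k} j h := by
    by_cases h₁ : i = j
    · have : k ≠ j := (h₁ ▸ h).ne'
      simp [Matrix.diagonal_apply_ne _ this]
    · simp [Matrix.diagonal_apply_ne _ h₁]

/-- The product of two quantum matrices with entries in different tensor factors. -/
theorem tmul {M : Matrix (Fin m) (Fin n) B} {N : Matrix (Fin n) (Fin p) C} (hM : IsManin M)
    (hN : IsManin N) : IsManin (Matrix.of fun i k => ∑ j, M i j ⊗ₜ[Zq] N j k) where
  comm {i j k l} h h' := by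
    simp only [Matrix.of_apply, Finset.sum_mul_sum, Algebra.TensorProduct.tmul_mul_tmul]
    -- The terms `(a, b)` and `(b, a)` are taken together: the corrections from the left factor
    -- cancel those from the right. On the diagonal the factors `q` and `q⁻¹` cancel.
    refine sum_sum_eq_of_pairs _ _ (fun a => ?_) (fun a b hab => ?_)
    · rw [hM.col a h, hN.row a h', ← TensorProduct.smul_tmul', TensorProduct.tmul_smul,
        smul_smul, q_mul_qInv, one_smul]
    · rw [hM.comm h hab, hM.cross h hab, hN.comm hab h', hN.cross hab h']
      simp only [TensorProduct.tmul_sub, TensorProduct.sub_tmul, TensorProduct.tmul_smul,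
        ← TensorProduct.smul_tmul']
      module
  cross {i j k l} h h' := by
    simp only [Matrix.of_apply, Finset.sum_mul_sum, Algebra.TensorProduct.tmul_mul_tmul,
      Finset.smul_sum, ← Finset.sum_sub_distrib]
    refine sum_sum_eq_of_pairs _ _ (fun a => ?_) (fun a b hab => ?_)
    · rw [hM.col a h, hN.row a h']
      simp only [TensorProduct.tmul_smul, ← TensorProduct.smul_tmul']
      module
    · rw [hM.cross h hab, hM.comm h hab, hN.comm hab h', hN.cross hab h']
      simp only [TensorProduct.tmul_sub, TensorProduct.sub_tmul, TensorProduct.tmul_smul,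
        ← TensorProduct.smul_tmul']
      module
  row i j l h' := by
    simp only [Matrix.of_apply, Finset.sum_mul_sum, Algebra.TensorProduct.tmul_mul_tmul,
      Finset.smul_sum]
    refine sum_sum_eq_of_pairs _ _ (fun a => ?_) (fun a b hab => ?_)
    · rw [hN.row a h', TensorProduct.tmul_smul]
    · rw [hM.row i hab, hN.comm hab h', hN.cross hab h']
      simp only [TensorProduct.tmul_sub, TensorProduct.tmul_smul, ← TensorProduct.smul_tmul']
      -- The two sides differ by a multiple of `q * qInv - 1`.
      linear_combination (norm := module)
        (-q_mul_qInv) • ((M i a * M i b) ⊗ₜ[Zq] (N b l * N a j))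
  col {i k} j h := by
    simp only [Matrix.of_apply, Finset.sum_mul_sum, Algebra.TensorProduct.tmul_mul_tmul,
      Finset.smul_sum]
    refine sum_sum_eq_of_pairs _ _ (fun a => ?_) (fun a b hab => ?_)
    · rw [hM.col a h, TensorProduct.smul_tmul']
    · rw [hM.comm h hab, hM.cross h hab, hN.col j hab]
      simp only [TensorProduct.sub_tmul, TensorProduct.tmul_smul, ← TensorProduct.smul_tmul']
      linear_combination (norm := module)
        (-q_mul_qInv) • ((M k a * M i b) ⊗ₜ[Zq] (N b j * N a j))

end IsManin

/-! ### The quantized coordinate algebra of rectangular matrices -/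

/-- The defining relations of the quantized coordinate algebra of `m × n` matrices. -/
inductive QMatRel (m n : ℕ) :
    FreeAlgebra Zq (Fin m × Fin n) → FreeAlgebra Zq (Fin m × Fin n) → Prop
  | comm (i j k l) (h : i < k) (h' : l < j) :
      QMatRel m n
        (FreeAlgebra.ι Zq (i, j) * FreeAlgebra.ι Zq (k, l))
        (FreeAlgebra.ι Zq (k, l) * FreeAlgebra.ι Zq (i, j))
  | cross (i j k l) (h : k < i) (h' : l < j) :
      QMatRel m n
        (FreeAlgebra.ι Zq (i, j) * FreeAlgebra.ι Zq (k, l))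
        (FreeAlgebra.ι Zq (k, l) * FreeAlgebra.ι Zq (i, j)
          - (q - qInv) • (FreeAlgebra.ι Zq (i, l) * FreeAlgebra.ι Zq (k, j)))
  | row (i j l) (h' : l < j) :
      QMatRel m n
        (FreeAlgebra.ι Zq (i, j) * FreeAlgebra.ι Zq (i, l))
        (qInv • (FreeAlgebra.ι Zq (i, l) * FreeAlgebra.ι Zq (i, j)))
  | col (i j k) (h : i < k) :
      QMatRel m n
        (FreeAlgebra.ι Zq (i, j) * FreeAlgebra.ι Zq (k, j))
        (q • (FreeAlgebra.ι Zq (k, j) * FreeAlgebra.ι Zq (i, j)))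

/-- The quantized coordinate algebra of `m × n` matrices. -/
def QMat (m n : ℕ) : Type := RingQuot (QMatRel m n)

noncomputable instance (m n : ℕ) : Ring (QMat m n) :=
  inferInstanceAs (Ring (RingQuot (QMatRel m n)))

noncomputable instance (m n : ℕ) : Algebra Zq (QMat m n) :=
  inferInstanceAs (Algebra Zq (RingQuot (QMatRel m n)))

namespace QMat

variable {l m n p : ℕ}

/-- The quotient map from the free algebra. -/
noncomputable def mk (m n : ℕ) : FreeAlgebra Zq (Fin m × Fin n) →ₐ[Zq] QMat m n :=
  RingQuot.mkAlgHom Zq (QMatRel m n)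

theorem mk_surjective (m n : ℕ) : Function.Surjective (mk m n) :=
  RingQuot.mkAlgHom_surjective Zq (QMatRel m n)

theorem mk_rel {a b : FreeAlgebra Zq (Fin m × Fin n)} (h : QMatRel m n a b) :
    mk m n a = mk m n b :=
  RingQuot.mkAlgHom_rel Zq h

/-- The matrix of generators. -/
noncomputable def X (m n : ℕ) : Matrix (Fin m) (Fin n) (QMat m n) :=
  Matrix.of fun i j => mk m n (FreeAlgebra.ι Zq (i, j))

theorem isManin_X (m n : ℕ) : IsManin (X m n) where
  comm h h' := by simpa only [X, map_mul] using! mk_rel (QMatRel.comm _ _ _ _ h h')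
  cross h h' := by
    simpa only [X, map_mul, map_sub, map_smul] using! mk_rel (QMatRel.cross _ _ _ _ h h')
  row _ _ _ h' := by simpa only [X, map_mul, map_smul] using! mk_rel (QMatRel.row _ _ _ h')
  col _ h := by simpa only [X, map_mul, map_smul] using! mk_rel (QMatRel.col _ _ _ h)

section Lift

variable {B : Type*} [Ring B] [Algebra Zq B]

/-- The universal property of the quantized coordinate algebra. -/
noncomputable def lift (M : Matrix (Fin m) (Fin n) B) (hM : IsManin M) : QMat m n →ₐ[Zq] B :=
  RingQuot.liftAlgHom Zq
    ⟨FreeAlgebra.lift Zq (fun p : Fin m × Fin n => M p.1 p.2), by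
      intro x y hxy
      cases hxy with
      | comm i j k l h h' => simpa using hM.comm h h'
      | cross i j k l h h' => simpa using hM.cross h h'
      | row i j l h' => simpa using hM.row i h'
      | col i j k h => simpa using hM.col j h⟩

@[simp]
theorem lift_X (M : Matrix (Fin m) (Fin n) B) (hM : IsManin M) (i : Fin m) (j : Fin n) :
    lift M hM (X m n i j) = M i j := by
  refine (RingQuot.liftAlgHom_mkAlgHom_apply _ _ _ _).trans ?_
  simp only [FreeAlgebra.lift_ι_apply]

theorem hom_ext {φ ψ : QMat m n →ₐ[Zq] B} (h : ∀ i j, φ (X m n i j) = ψ (X m n i j)) : φ = ψ := by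
  refine RingQuot.ringQuot_ext' _ _ _ (FreeAlgebra.hom_ext ?_)
  funext p
  exact h p.1 p.2

theorem lift_monomial (M : Matrix (Fin m) (Fin n) B) (hM : IsManin M)
    (A : Matrix (Fin m) (Fin n) ℕ) : lift M hM (monomial (X m n) A) = monomial M A := by
  rw [map_monomial]
  congr 1
  ext i j
  simp

end Lift

theorem induction {P : QMat m n → Prop} (hs : ∀ r, P (algebraMap Zq _ r))
    (hX : ∀ i j, P (X m n i j)) (hm : ∀ a b, P a → P b → P (a * b))
    (ha : ∀ a b, P a → P b → P (a + b)) (a : QMat m n) : P a := by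
  obtain ⟨a, rfl⟩ := mk_surjective m n a
  induction a using FreeAlgebra.induction with
  | grade0 r => simpa using hs r
  | grade1 p => exact hX p.1 p.2
  | mul a b h₁ h₂ => simpa using hm _ _ h₁ h₂
  | add a b h₁ h₂ => simpa using ha _ _ h₁ h₂

/-- The comultiplication `x_{i,k} ↦ ∑ j, x_{i,j} ⊗ x_{j,k}`. -/
noncomputable def comul (l m n : ℕ) : QMat l n →ₐ[Zq] QMat l m ⊗[Zq] QMat m n :=
  lift _ ((isManin_X l m).tmul (isManin_X m n))

theorem comul_X (i : Fin l) (k : Fin n) :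
    comul l m n (X l n i k) = ∑ j, X l m i j ⊗ₜ[Zq] X m n j k :=
  lift_X _ _ _ _

/-- On a generator both sides are the sum over two middle indices of a product of three generators.
-/
theorem comul_coassoc (l m n p : ℕ) :
    (Algebra.TensorProduct.assoc Zq Zq Zq (QMat l m) (QMat m n) (QMat n p)).toAlgHom.comp
      ((Algebra.TensorProduct.map (comul l m n) (AlgHom.id Zq (QMat n p))).comp (comul l n p)) =
    (Algebra.TensorProduct.map (AlgHom.id Zq (QMat l m)) (comul m n p)).comp (comul l m p) := by
  refine hom_ext fun i j => ?_
  simp [comul_X, TensorProduct.sum_tmul, TensorProduct.tmul_sum]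
  exact Finset.sum_comm

/-- The block diagonal matrix of the generators of the two tensor factors. -/
noncomputable def blockX (a b c d : ℕ) :
    Matrix (Fin (a + b)) (Fin (c + d)) (QMat a c ⊗[Zq] QMat b d) :=
  blockDiag (Matrix.of fun i j => X a c i j ⊗ₜ 1) (Matrix.of fun i j => 1 ⊗ₜ X b d i j)

theorem isManin_blockX (a b c d : ℕ) : IsManin (blockX a b c d) := by
  refine IsManin.blockDiag
    ((isManin_X a c).map (Algebra.TensorProduct.includeLeft : _ →ₐ[Zq] QMat a c ⊗[Zq] QMat b d))
    ((isManin_X b d).map (Algebra.TensorProduct.includeRight : _ →ₐ[Zq] QMat a c ⊗[Zq] QMat b d))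
    fun i j k l => ?_
  simp [Commute, SemiconjBy]

/-- The algebra homomorphism killing the generators outside two diagonal blocks. -/
noncomputable def blockProj (a b c d : ℕ) :
    QMat (a + b) (c + d) →ₐ[Zq] QMat a c ⊗[Zq] QMat b d :=
  lift (blockX a b c d) (isManin_blockX a b c d)

/-! ### Restriction to two diagonal blocks. -/

section BlockProj

variable {a b c d : ℕ}

theorem blockProj_X (i : Fin (a + b)) (j : Fin (c + d)) :
    blockProj a b c d (X _ _ i j) = blockX a b c d i j :=
  lift_X _ _ _ _

theorem blockProj_monomial_blockDiag (A : Matrix (Fin a) (Fin c) ℕ)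
    (A' : Matrix (Fin b) (Fin d) ℕ) :
    blockProj a b c d (monomial (X _ _) (blockDiag A A')) =
      monomial (X a c) A ⊗ₜ monomial (X b d) A' := by
  rw [blockProj, lift_monomial, monomial_blockDiag]
  have h₁ : (blockX a b c d).submatrix (Fin.castAdd b) (Fin.castAdd d) =
      (X a c).map (Algebra.TensorProduct.includeLeft : _ →ₐ[Zq] QMat a c ⊗[Zq] QMat b d) := by
    ext i j
    simp [blockX]
  have h₂ : (blockX a b c d).submatrix (Fin.natAdd a) (Fin.natAdd c) =
      (X b d).map (Algebra.TensorProduct.includeRight : _ →ₐ[Zq] QMat a c ⊗[Zq] QMat b d) := by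
    ext i j
    simp [blockX]
  rw [h₁, h₂, ← map_monomial, ← map_monomial]
  simp

theorem blockProj_monomial_of_ne (E : Matrix (Fin (a + b)) (Fin (c + d)) ℕ)
    (hE : ∀ A A', E ≠ blockDiag A A') : blockProj a b c d (monomial (X _ _) E) = 0 := by
  rw [blockProj, lift_monomial]
  by_contra h
  refine hE _ _ (eq_blockDiag_of_eq_zero E (fun i j => ?_) (fun i j => ?_))
  · by_contra h'
    exact h (monomial_eq_zero _ _ _ _ (blockDiag_castAdd_natAdd _ _ i j) h')
  · by_contra h'
    exact h (monomial_eq_zero _ _ _ _ (blockDiag_natAdd_castAdd _ _ i j) h')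

/-- Dual form of the blockwise multiplication of block diagonal matrices: of the middle indices only
those in the common block contribute. It becomes the interchange law in `conv_tensor`. -/
theorem comul_blockProj (a b c d e f : ℕ) :
    (Algebra.TensorProduct.map (blockProj a b c d) (blockProj c d e f)).comp
      (comul (a + b) (c + d) (e + f)) =
    (Algebra.TensorProduct.tensorTensorTensorComm Zq Zq Zq Zq _ _ _ _).toAlgHom.comp
      ((Algebra.TensorProduct.map (comul a c e) (comul b d f)).comp (blockProj a b e f)) := by
  refine hom_ext fun i k => ?_
  simp only [AlgHom.comp_apply, comul_X, map_sum, Algebra.TensorProduct.map_tmul,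
    blockProj_X, blockX]
  rw [← finSumFinEquiv.sum_comp]
  induction i using Fin.addCases <;> induction k using Fin.addCases <;>
    simp [comul_X, TensorProduct.sum_tmul, TensorProduct.tmul_sum,
      Algebra.TensorProduct.one_def]

end BlockProj

/-! ### Submatrices and insertion of zeros. -/

section Embedding

variable {a b c : ℕ}

/-- The embedding of quantized coordinate algebras corresponding to the submatrix with rows and
columns numbered by the images of `f` and `g`. -/
noncomputable def embed (f : Fin a ↪o Fin m) (g : Fin b ↪o Fin n) : QMat a b →ₐ[Zq] QMat m n :=
  lift _ ((isManin_X m n).submatrix f.strictMono g.strictMono)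

/-- The algebra homomorphism killing the generators outside the submatrix with rows and
columns numbered by the images of `f` and `g`. -/
noncomputable def retract (f : Fin a ↪o Fin m) (g : Fin b ↪o Fin n) : QMat m n →ₐ[Zq] QMat a b :=
  lift _ ((isManin_X a b).zeroExtend f g)

variable (f : Fin a ↪o Fin m) (g : Fin b ↪o Fin n)

theorem embed_monomial (A : Matrix (Fin a) (Fin b) ℕ) :
    embed f g (monomial (X a b) A) = monomial (X m n) (zeroExtend f g A) := by
  rw [embed, lift_monomial, monomial_zeroExtend]

theorem retract_monomial_zeroExtend (A : Matrix (Fin a) (Fin b) ℕ) :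
    retract f g (monomial (X m n) (zeroExtend f g A)) = monomial (X a b) A := by
  rw [retract, lift_monomial, monomial_zeroExtend]
  congr 1
  ext i j
  simp

theorem retract_monomial_of_ne (E : Matrix (Fin m) (Fin n) ℕ) (hE : ∀ A, E ≠ zeroExtend f g A) :
    retract f g (monomial (X m n) E) = 0 := by
  rw [retract, lift_monomial]
  by_contra h
  refine hE _ (eq_zeroExtend_of_eq_zero f g E (fun i j hi => ?_) (fun i j hj => ?_))
  · by_contra h'
    exact h (monomial_eq_zero _ _ _ _ (zeroExtend_of_left f g _ hi j) h')
  · by_contra h'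
    exact h (monomial_eq_zero _ _ _ _ (zeroExtend_of_right f g _ i hj) h')

/-- The comultiplication of a large algebra sums over all middle indices, but `retract` kills those
outside the image of `g`. This makes the structure constants independent of the inserted zeros. -/
theorem retract_comul_embed (f : Fin a ↪o Fin l) (g : Fin b ↪o Fin m) (h : Fin c ↪o Fin n) :
    (Algebra.TensorProduct.map (retract f g) (retract g h)).comp
      ((comul l m n).comp (embed f h)) = comul a b c := by
  refine hom_ext fun i k => ?_
  simp only [AlgHom.comp_apply, embed, lift_X, Matrix.submatrix_apply, comul_X, map_sum,
    Algebra.TensorProduct.map_tmul, retract]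
  symm
  refine Finset.sum_of_injOn g g.injective.injOn (fun _ _ => Finset.mem_coe.2 (Finset.mem_univ _))
    (fun j _ hj => ?_) fun j _ => ?_
  · rw [zeroExtend_of_left g h _ (by simpa using hj), TensorProduct.tmul_zero]
  · simp

end Embedding

/-- The algebra homomorphism to the commutative polynomial ring with `x_{i,j} ↦ δ_{i,j} t_i`. -/
noncomputable def torus (n : ℕ) : QMat n n →ₐ[Zq] MvPolynomial (Fin n) Zq :=
  lift _ (IsManin.diagonal MvPolynomial.X)

theorem torus_monomial_diagonal (s : Fin n → ℕ) :
    torus n (monomial (X n n) (Matrix.diagonal s)) =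
      MvPolynomial.monomial (Finsupp.equivFunOnFinite.symm s) 1 := by
  rw [torus, lift_monomial, monomial_eq_prod, MvPolynomial.monomial_eq, Finsupp.prod_fintype _ _
    (by simp)]
  simp only [map_one, one_mul]
  refine Finset.prod_congr rfl fun j _ => ?_
  rw [Finset.prod_eq_single j]
  · simp
  · intro i _ h
    simp [h]
  · simp

theorem torus_monomial_of_ne (E : Matrix (Fin n) (Fin n) ℕ) (hE : ∀ s, E ≠ Matrix.diagonal s) :
    torus n (monomial (X n n) E) = 0 := by
  rw [torus, lift_monomial]
  by_contra h
  refine hE (fun i => E i i) ?_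
  ext i j
  by_cases hij : i = j
  · simp [hij]
  · rw [Matrix.diagonal_apply_ne _ hij]
    by_contra h'
    exact h (monomial_eq_zero _ _ _ _ (Matrix.diagonal_apply_ne _ hij) h')

/-- The composite sends `x_{i,j}` to `t_i ⊗ x_{i,j}`, hence multiplies a monomial by the torus
monomial of its row sums. -/
theorem torus_comul_left (A : Matrix (Fin m) (Fin n) ℕ) :
    Algebra.TensorProduct.map (torus m) (AlgHom.id Zq (QMat m n))
      (comul m m n (monomial (X m n) A)) =
    MvPolynomial.monomial (Finsupp.equivFunOnFinite.symm fun i => ∑ j, A i j) 1 ⊗ₜ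
      monomial (X m n) A := by
  rw [← AlgHom.comp_apply, map_monomial]
  trans monomial (Matrix.of fun i j => (Matrix.of fun i (_ : Fin n) =>
    (MvPolynomial.X i : MvPolynomial (Fin m) Zq)) i j ⊗ₜ[Zq] X m n i j) A
  · congr 1
    ext i j
    simp only [Matrix.map_apply, AlgHom.comp_apply, comul_X, map_sum,
      Algebra.TensorProduct.map_tmul, torus, lift_X, Matrix.of_apply]
    rw [Finset.sum_eq_single i]
    · simp
    · intro k _ hk
      simp [Matrix.diagonal_apply_ne _ hk.symm]
    · simp
  · rw [monomial_tmul, monomial_eq_prod, MvPolynomial.monomial_eq, Finsupp.prod_fintype _ _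
      (by simp), Finset.prod_comm]
    simp [Finset.prod_pow_eq_pow_sum]

theorem torus_comul_right (A : Matrix (Fin m) (Fin n) ℕ) :
    Algebra.TensorProduct.map (AlgHom.id Zq (QMat m n)) (torus n)
      (comul m n n (monomial (X m n) A)) =
    monomial (X m n) A ⊗ₜ
      MvPolynomial.monomial (Finsupp.equivFunOnFinite.symm fun j => ∑ i, A i j) 1 := by
  rw [← AlgHom.comp_apply, map_monomial]
  trans monomial (Matrix.of fun i j => X m n i j ⊗ₜ[Zq] (Matrix.of fun (_ : Fin m) j =>
    (MvPolynomial.X j : MvPolynomial (Fin n) Zq)) i j) A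
  · congr 1
    ext i j
    simp only [Matrix.map_apply, AlgHom.comp_apply, comul_X, map_sum,
      Algebra.TensorProduct.map_tmul, torus, lift_X, Matrix.of_apply]
    rw [Finset.sum_eq_single j]
    · simp
    · intro k _ hk
      simp [Matrix.diagonal_apply_ne _ hk]
    · simp
  · rw [monomial_tmul, monomial_eq_prod, MvPolynomial.monomial_eq, Finsupp.prod_fintype _ _
      (by simp)]
    simp [Finset.prod_pow_eq_pow_sum]

end QMat

/-! ### A representation by weighted shift operators -/

section ShiftOperators

/-- The weighted shift operator `e_a ↦ c(a) e_{a + v}`. -/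
noncomputable def shiftOp {m : ℕ} (c : (Fin m → ℤ) → Zq) (v : Fin m → ℤ) :
    Module.End Zq ((Fin m → ℤ) →₀ Zq) :=
  Finsupp.linearCombination Zq fun a => Finsupp.single (a + v) (c a)

variable {m : ℕ}

@[simp]
theorem shiftOp_single (c : (Fin m → ℤ) → Zq) (v a : Fin m → ℤ) (r : Zq) :
    shiftOp c v (Finsupp.single a r) = Finsupp.single (a + v) (r * c a) := by
  simp [shiftOp]

/-- Products of weighted shifts are weighted shifts, so a relation between them becomes an identity
of coefficient functions. With all of `ℤ^m` as index set, no boundary cases arise. -/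
theorem shiftOp_mul (c d : (Fin m → ℤ) → Zq) (v w : Fin m → ℤ) :
    shiftOp c v * shiftOp d w = shiftOp (fun a => c (a + w) * d a) (v + w) := by
  ext a : 2
  simp [add_assoc, add_comm v w, mul_comm]

theorem smul_shiftOp (r : Zq) (c : (Fin m → ℤ) → Zq) (v : Fin m → ℤ) :
    r • shiftOp c v = shiftOp (fun a => r * c a) v := by
  ext a : 2
  simp

theorem shiftOp_eq_sub {c d e : (Fin m → ℤ) → Zq} {u v w : Fin m → ℤ}
    (h : ∀ a, c a = d a - e a) (hv : u = v) (hw : u = w) :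
    shiftOp c u = shiftOp d v - shiftOp e w := by
  subst hv hw
  ext a : 2
  simp [h, Finsupp.single_sub]

theorem shiftOp_congr {c d : (Fin m → ℤ) → Zq} {v w : Fin m → ℤ} (h : ∀ a, c a = d a)
    (h' : v = w) : shiftOp c v = shiftOp d w := by
  rw [funext h, h']

/-- The sum of the entries of `a` after the `i`th one. -/
def tailSum (i : Fin m) : (Fin m → ℤ) →+ ℤ where
  toFun a := ∑ k ∈ Finset.Ioi i, a k
  map_zero' := by simp
  map_add' a b := by simp [Finset.sum_add_distrib]

theorem tailSum_single (i k : Fin m) :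
    tailSum i (Pi.single k 1) = if i < k then 1 else 0 := by
  simp [tailSum]

/-- The action of the generators of the first column. -/
noncomputable def raiseOp (i : Fin m) : Module.End Zq ((Fin m → ℤ) →₀ Zq) :=
  shiftOp (fun a => LaurentPolynomial.T (tailSum i a)) (Pi.single i 1)

/-- The operators by which generators of other columns are moved past the first column. -/
noncomputable def exchangeOp (i j : Fin m) : Module.End Zq ((Fin m → ℤ) →₀ Zq) :=
  if i < j then 0
  else if i = j then shiftOp (fun a => LaurentPolynomial.T (-a i)) 0
  else shiftOp (fun a => (LaurentPolynomial.T (-a j) - LaurentPolynomial.T (a j)) *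
    LaurentPolynomial.T (tailSum i a - tailSum j a)) (Pi.single i 1 - Pi.single j 1)

theorem exchangeOp_of_lt {i j : Fin m} (h : i < j) : exchangeOp i j = 0 := if_pos h

theorem exchangeOp_self (i : Fin m) :
    exchangeOp i i = shiftOp (fun a => LaurentPolynomial.T (-a i)) 0 := by
  simp [exchangeOp]

theorem exchangeOp_of_gt {i j : Fin m} (h : j < i) :
    exchangeOp i j = shiftOp (fun a => (LaurentPolynomial.T (-a j) - LaurentPolynomial.T (a j)) *
      LaurentPolynomial.T (tailSum i a - tailSum j a)) (Pi.single i 1 - Pi.single j 1) := by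
  simp [exchangeOp, h.not_gt, h.ne']

/-- With a single column only `col` has content: raising row `k > i` first increases `tailSum i` by
one, which produces `q`. -/
theorem isManin_raiseOp : IsManin (Matrix.of fun (i : Fin m) (_ : Fin 1) => raiseOp i) where
  comm h h' := by omega
  cross h h' := by omega
  row i j l h' := by omega
  col {i k} j h := by
    simp only [Matrix.of_apply, raiseOp, shiftOp_mul, smul_shiftOp, q]
    refine shiftOp_congr (fun a => ?_) (by abel)
    simp only [map_add, tailSum_single, h, h.not_gt, if_true, if_false, ← LaurentPolynomial.T_add]
    congr 1
    ring

/-- This lemma and the next two are the relations of `columnOp` between its first column and a later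
one, according to the order of the two rows. -/
theorem exchangeOp_mul_raiseOp_of_lt {i k : Fin m} (j : Fin m) (h : i < k) :
    exchangeOp i j * raiseOp k = raiseOp k * exchangeOp i j := by
  unfold raiseOp
  rcases lt_trichotomy i j with hij | rfl | hij
  · simp [exchangeOp_of_lt hij]
  · rw [exchangeOp_self]
    simp only [shiftOp_mul]
    refine shiftOp_congr (fun a => ?_) (by abel)
    simp only [Pi.add_apply, map_add, map_zero, Pi.single_apply, h.ne, if_false,
      ← LaurentPolynomial.T_add]
    ring_nf
  · have hjk := hij.trans h
    rw [exchangeOp_of_gt hij]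
    simp only [shiftOp_mul]
    refine shiftOp_congr (fun a => ?_) (by abel)
    simp only [Pi.add_apply, map_add, map_sub, tailSum_single, Pi.single_apply, h, h.not_gt, hjk,
      hjk.not_gt, hjk.ne, if_true, if_false, sub_mul, mul_sub, ← LaurentPolynomial.T_add]
    ring_nf

theorem exchangeOp_mul_raiseOp_self (i j : Fin m) :
    exchangeOp i j * raiseOp i = qInv • (raiseOp i * exchangeOp i j) := by
  unfold raiseOp
  rcases lt_trichotomy i j with hij | rfl | hij
  · simp [exchangeOp_of_lt hij]
  · rw [exchangeOp_self]
    simp only [shiftOp_mul, smul_shiftOp, qInv]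
    refine shiftOp_congr (fun a => ?_) (by abel)
    simp only [Pi.add_apply, map_add, map_zero, Pi.single_apply, if_true,
      ← LaurentPolynomial.T_add]
    ring_nf
  · rw [exchangeOp_of_gt hij]
    simp only [shiftOp_mul, smul_shiftOp, qInv]
    refine shiftOp_congr (fun a => ?_) (by abel)
    simp only [Pi.add_apply, map_add, map_sub, tailSum_single, Pi.single_apply, lt_irrefl, hij,
      hij.not_gt, hij.ne, if_true, if_false, sub_mul, mul_sub, ← LaurentPolynomial.T_add]
    ring_nf

theorem exchangeOp_mul_raiseOp_of_gt {i k : Fin m} (j : Fin m) (h : k < i) :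
    exchangeOp i j * raiseOp k =
      raiseOp k * exchangeOp i j - (q - qInv) • (raiseOp i * exchangeOp k j) := by
  unfold raiseOp
  rcases lt_trichotomy i j with hij | rfl | hij
  · rw [exchangeOp_of_lt hij, exchangeOp_of_lt (h.trans hij), zero_mul,
      mul_zero, mul_zero, smul_zero]
    exact (sub_zero (G := Module.End Zq ((Fin m → ℤ) →₀ Zq)) _).symm
  · rw [exchangeOp_of_lt h, mul_zero, smul_zero]
    refine Eq.trans ?_ (sub_zero (G := Module.End Zq ((Fin m → ℤ) →₀ Zq)) _).symm
    rw [exchangeOp_self]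
    simp only [shiftOp_mul]
    refine shiftOp_congr (fun a => ?_) (by abel)
    simp only [Pi.add_apply, map_add, map_zero, Pi.single_apply, h.ne', if_false,
      ← LaurentPolynomial.T_add]
    ring_nf
  · rcases lt_trichotomy k j with hkj | rfl | hkj
    · rw [exchangeOp_of_lt hkj, mul_zero, smul_zero]
      refine Eq.trans ?_ (sub_zero (G := Module.End Zq ((Fin m → ℤ) →₀ Zq)) _).symm
      rw [exchangeOp_of_gt hij]
      simp only [shiftOp_mul]
      refine shiftOp_congr (fun a => ?_) (by abel)
      simp only [Pi.add_apply, map_add, map_sub, tailSum_single, Pi.single_apply, h, h.not_gt, hkj,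
        hkj.not_gt, hkj.ne', if_true, if_false, sub_mul, mul_sub, ← LaurentPolynomial.T_add]
      ring_nf
    -- For `k = j`, raising row `j` first changes `a j` by one, and the coefficients of the two
    -- products differ by exactly `-(q - q⁻¹) q^(tailSum i a - a j)`.
    · rw [exchangeOp_of_gt hij, exchangeOp_self]
      simp only [shiftOp_mul, smul_shiftOp, q, qInv]
      refine shiftOp_eq_sub (fun a => ?_) (by abel) (by abel)
      simp only [Pi.add_apply, map_add, map_sub, map_zero, tailSum_single, Pi.single_apply,
        lt_irrefl, hij, hij.not_gt, if_true, if_false, sub_mul, mul_sub, ← LaurentPolynomial.T_add]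
      ring_nf
    · rw [exchangeOp_of_gt hij, exchangeOp_of_gt hkj]
      simp only [shiftOp_mul, smul_shiftOp, q, qInv]
      refine shiftOp_eq_sub (fun a => ?_) (by abel) (by abel)
      simp only [Pi.add_apply, map_add, map_sub, tailSum_single, Pi.single_apply, hij.not_gt, h,
        h.not_gt, hkj, hkj.not_gt, hkj.ne, if_true, if_false, sub_mul, mul_sub,
        ← LaurentPolynomial.T_add]
      ring_nf

theorem exchangeOp_comm {i j k l : Fin m} (h : i < k) (h' : l < j) :
    exchangeOp i j * exchangeOp k l = exchangeOp k l * exchangeOp i j := by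
  rcases lt_trichotomy i j with hij | rfl | hij
  · simp [exchangeOp_of_lt hij]
  · have hlk := h'.trans h
    rw [exchangeOp_self, exchangeOp_of_gt hlk]
    simp only [shiftOp_mul]
    refine shiftOp_congr (fun a => ?_) (by abel)
    simp only [Pi.add_apply, Pi.sub_apply, Pi.zero_apply, map_add, map_zero, Pi.single_apply, h.ne,
      h'.ne', if_false, sub_mul, mul_sub, ← LaurentPolynomial.T_add]
    ring_nf
  · have hli := h'.trans hij
    have hlk := hli.trans h
    have hjk := hij.trans h
    rw [exchangeOp_of_gt hij, exchangeOp_of_gt hlk]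
    simp only [shiftOp_mul]
    refine shiftOp_congr (fun a => ?_) (by abel)
    simp only [Pi.add_apply, Pi.sub_apply, map_add, map_sub, tailSum_single, Pi.single_apply, h,
      h.not_gt, h', h'.not_gt, h'.ne, h'.ne', hli, hli.not_gt, hli.ne, hjk, hjk.not_gt, hjk.ne,
      if_true, if_false, sub_mul, mul_sub, ← LaurentPolynomial.T_add]
    ring_nf

theorem exchangeOp_row (i : Fin m) {j l : Fin m} (h' : l < j) :
    exchangeOp i j * exchangeOp i l = qInv • (exchangeOp i l * exchangeOp i j) := by
  rcases lt_trichotomy i j with hij | rfl | hij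
  · simp [exchangeOp_of_lt hij]
  · rw [exchangeOp_self, exchangeOp_of_gt h']
    simp only [shiftOp_mul, smul_shiftOp, qInv]
    refine shiftOp_congr (fun a => ?_) (by abel)
    simp only [Pi.add_apply, Pi.sub_apply, Pi.zero_apply, map_add, map_zero, Pi.single_apply,
      h'.ne', if_true, if_false, sub_mul, mul_sub, ← LaurentPolynomial.T_add]
    ring_nf
  · have hli := h'.trans hij
    rw [exchangeOp_of_gt hij, exchangeOp_of_gt hli]
    simp only [shiftOp_mul, smul_shiftOp, qInv]
    refine shiftOp_congr (fun a => ?_) (by abel)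
    simp only [Pi.add_apply, Pi.sub_apply, map_add, map_sub, tailSum_single, Pi.single_apply,
      lt_irrefl, h', h'.not_gt, h'.ne, h'.ne', hij, hij.not_gt, hij.ne, hli, hli.not_gt, hli.ne,
      if_true, if_false, sub_mul, mul_sub, ← LaurentPolynomial.T_add]
    ring_nf

theorem exchangeOp_col {i k : Fin m} (j : Fin m) (h : i < k) :
    exchangeOp i j * exchangeOp k j = q • (exchangeOp k j * exchangeOp i j) := by
  rcases lt_trichotomy i j with hij | rfl | hij
  · simp [exchangeOp_of_lt hij]
  · rw [exchangeOp_self, exchangeOp_of_gt h]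
    simp only [shiftOp_mul, smul_shiftOp, q]
    refine shiftOp_congr (fun a => ?_) (by abel)
    simp only [Pi.add_apply, Pi.sub_apply, Pi.zero_apply, map_add, map_zero, Pi.single_apply, h.ne,
      if_true, if_false, sub_mul, mul_sub, ← LaurentPolynomial.T_add]
    ring_nf
  · have hjk := hij.trans h
    rw [exchangeOp_of_gt hij, exchangeOp_of_gt hjk]
    simp only [shiftOp_mul, smul_shiftOp, q]
    refine shiftOp_congr (fun a => ?_) (by abel)
    simp only [Pi.add_apply, Pi.sub_apply, map_add, map_sub, tailSum_single, Pi.single_apply,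
      lt_irrefl, h, h.not_gt, hij, hij.not_gt, hij.ne, hjk, hjk.not_gt, hjk.ne, if_true, if_false,
      sub_mul, mul_sub, ← LaurentPolynomial.T_add]
    ring_nf

/-- The case of the cross relation in which the correction term contains `exchangeOp k j = 0`, by
triangularity. -/
theorem exchangeOp_comm_of_lt_lt {i j k l : Fin m} (h : k < i) (h' : l < j) (hkj : k < j) :
    exchangeOp i j * exchangeOp k l = exchangeOp k l * exchangeOp i j := by
  rcases lt_trichotomy k l with hkl | rfl | hkl
  · simp [exchangeOp_of_lt hkl]
  · rcases lt_trichotomy i j with hij | rfl | hij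
    · simp [exchangeOp_of_lt hij]
    · rw [exchangeOp_self, exchangeOp_self]
      simp only [shiftOp_mul]
      refine shiftOp_congr (fun a => ?_) (by abel)
      simp only [Pi.add_apply, Pi.zero_apply, ← LaurentPolynomial.T_add]
      ring_nf
    · rw [exchangeOp_self, exchangeOp_of_gt hij]
      simp only [shiftOp_mul]
      refine shiftOp_congr (fun a => ?_) (by abel)
      simp only [Pi.add_apply, Pi.sub_apply, Pi.zero_apply, map_add, map_zero, Pi.single_apply,
        h.ne, h'.ne, if_false, sub_mul, mul_sub, ← LaurentPolynomial.T_add]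
      ring_nf
  · have hli := hkl.trans h
    rcases lt_trichotomy i j with hij | rfl | hij
    · simp [exchangeOp_of_lt hij]
    · rw [exchangeOp_self, exchangeOp_of_gt hkl]
      simp only [shiftOp_mul]
      refine shiftOp_congr (fun a => ?_) (by abel)
      simp only [Pi.add_apply, Pi.sub_apply, Pi.zero_apply, map_add, map_zero, Pi.single_apply,
        h.ne', h'.ne', if_false, sub_mul, mul_sub, ← LaurentPolynomial.T_add]
      ring_nf
    · rw [exchangeOp_of_gt hij, exchangeOp_of_gt hkl]
      simp only [shiftOp_mul]
      refine shiftOp_congr (fun a => ?_) (by abel)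
      simp only [Pi.add_apply, Pi.sub_apply, map_add, map_sub, tailSum_single, Pi.single_apply, h,
        h.not_gt, h', h'.not_gt, h'.ne, h'.ne', hkj, hkj.not_gt, hkj.ne', hli, hli.not_gt, hli.ne,
        if_true, if_false, sub_mul, mul_sub, ← LaurentPolynomial.T_add]
      ring_nf

theorem exchangeOp_cross {i j k l : Fin m} (h : k < i) (h' : l < j) :
    exchangeOp i j * exchangeOp k l =
      exchangeOp k l * exchangeOp i j - (q - qInv) • (exchangeOp i l * exchangeOp k j) := by
  rcases lt_trichotomy k j with hkj | rfl | hkj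
  · rw [exchangeOp_of_lt hkj, exchangeOp_comm_of_lt_lt h h' hkj, mul_zero, smul_zero]
    exact (sub_zero (G := Module.End Zq ((Fin m → ℤ) →₀ Zq)) _).symm
  · have hli := h'.trans h
    rw [exchangeOp_of_gt h, exchangeOp_of_gt h', exchangeOp_of_gt hli, exchangeOp_self]
    simp only [shiftOp_mul, smul_shiftOp, q, qInv]
    refine shiftOp_eq_sub (fun a => ?_) (by abel) (by abel)
    simp only [Pi.add_apply, Pi.sub_apply, Pi.zero_apply, map_add, map_sub, map_zero,
      tailSum_single, Pi.single_apply, lt_irrefl, h, h.not_gt, h', h'.not_gt, h'.ne, h'.ne', hli,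
      hli.not_gt, hli.ne, if_true, if_false, sub_mul, mul_sub, ← LaurentPolynomial.T_add]
    ring_nf
  · have hij := hkj.trans h
    have hli := h'.trans hij
    have hlk := h'.trans hkj
    rw [exchangeOp_of_gt hij, exchangeOp_of_gt hkj, exchangeOp_of_gt hli, exchangeOp_of_gt hlk]
    simp only [shiftOp_mul, smul_shiftOp, q, qInv]
    refine shiftOp_eq_sub (fun a => ?_) (by abel) (by abel)
    simp only [Pi.add_apply, Pi.sub_apply, map_add, map_sub, tailSum_single, Pi.single_apply, h,
      h.not_gt, h', h'.not_gt, h'.ne, h'.ne', hli, hli.not_gt, hli.ne, hij.not_gt, hlk, hlk.ne,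
      hkj, hkj.not_gt, hkj.ne, if_true, if_false, sub_mul, mul_sub, ← LaurentPolynomial.T_add]
    ring_nf

/-- The quantum matrix with first column the operators `raiseOp` and the other columns given by
`exchangeOp`. -/
noncomputable def columnOp (m : ℕ) :
    Matrix (Fin m) (Fin (1 + m)) (Module.End Zq ((Fin m → ℤ) →₀ Zq)) :=
  Matrix.of fun i => Fin.addCases (fun _ => raiseOp i) (exchangeOp i)

@[simp]
theorem columnOp_castAdd (i : Fin m) (j : Fin 1) :
    columnOp m i (Fin.castAdd m j) = raiseOp i := by
  simp [columnOp]

@[simp]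
theorem columnOp_natAdd (i j : Fin m) : columnOp m i (Fin.natAdd 1 j) = exchangeOp i j := by
  simp [columnOp]

theorem isManin_columnOp (m : ℕ) : IsManin (columnOp m) where
  comm {i j k l} h h' := by
    induction j using Fin.addCases <;> induction l using Fin.addCases <;>
      simp only [Fin.lt_def, Fin.val_castAdd, Fin.val_natAdd] at h' <;>
      simp only [columnOp_castAdd, columnOp_natAdd]
    · omega
    · omega
    · exact exchangeOp_mul_raiseOp_of_lt _ h
    · exact exchangeOp_comm h (Fin.lt_def.2 (by omega))
  cross {i j k l} h h' := by
    induction j using Fin.addCases <;> induction l using Fin.addCases <;>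
      simp only [Fin.lt_def, Fin.val_castAdd, Fin.val_natAdd] at h' <;>
      simp only [columnOp_castAdd, columnOp_natAdd]
    · omega
    · omega
    · exact exchangeOp_mul_raiseOp_of_gt _ h
    · exact exchangeOp_cross h (Fin.lt_def.2 (by omega))
  row i j l h' := by
    induction j using Fin.addCases <;> induction l using Fin.addCases <;>
      simp only [Fin.lt_def, Fin.val_castAdd, Fin.val_natAdd] at h' <;>
      simp only [columnOp_castAdd, columnOp_natAdd]
    · omega
    · omega
    · exact exchangeOp_mul_raiseOp_self _ _
    · exact exchangeOp_row i (Fin.lt_def.2 (by omega))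
  col {i k} j h := by
    induction j using Fin.addCases <;> simp only [columnOp_castAdd, columnOp_natAdd]
    · exact isManin_raiseOp.col 0 h
    · exact exchangeOp_col _ h

end ShiftOperators

/-! ### Linear independence of the normally ordered monomials -/

section LinearIndependence

variable {m n : ℕ}

/-- Below the diagonal the factor `q^(-a j) - q^(a j)` vanishes at `a = 0`, so the exchange matrix
acts on the vacuum `e_0` as the identity matrix. -/
theorem exchangeOp_vacuum (i j : Fin m) :
    exchangeOp i j (Finsupp.single 0 1) = if i = j then Finsupp.single 0 1 else 0 := by
  rcases lt_trichotomy i j with h | rfl | h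
  · simp [exchangeOp_of_lt h, h.ne]
  · simp [exchangeOp_self]
  · simp [exchangeOp_of_gt h, h.ne']

/-- `tailSum i` ignores the entry `i` itself, so it stays zero and every coefficient is `q^0`. -/
theorem raiseOp_pow_single (i : Fin m) (k : ℕ) (v : Fin m → ℤ) (hv : tailSum i v = 0) :
    (raiseOp i ^ k) (Finsupp.single v 1) = Finsupp.single ((k : ℤ) • Pi.single i 1 + v) 1 := by
  induction k with
  | zero => simp
  | succ k ih =>
    rw [pow_succ', Module.End.mul_apply, ih, raiseOp, shiftOp_single, map_add, map_zsmul, hv,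
      tailSum_single, if_neg (lt_irrefl i)]
    simp only [smul_zero, add_zero, LaurentPolynomial.T_zero, mul_one]
    congr 1
    push_cast
    rw [add_smul, one_smul]
    abel

/-- The rightmost operator acts first. With decreasing rows, each operator meets a vector supported
on smaller rows, so no power of `q` appears. -/
theorem prod_raiseOp_vacuum (s : Fin m → ℕ) (l : List (Fin m)) (hl : l.Pairwise (· > ·)) :
    (l.map fun i => raiseOp i ^ s i).prod (Finsupp.single 0 1) =
      Finsupp.single ((l.map fun i => (s i : ℤ) • (Pi.single i 1 : Fin m → ℤ)).sum) 1 := by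
  induction l with
  | nil => simp
  | cons i l ih =>
    rw [List.pairwise_cons] at hl
    rw [List.map_cons, List.prod_cons, Module.End.mul_apply, ih hl.2, raiseOp_pow_single,
      List.map_cons, List.sum_cons]
    rw [map_list_sum, List.map_map]
    refine List.sum_eq_zero fun x hx => ?_
    obtain ⟨k, hk, rfl⟩ := List.mem_map.1 hx
    rw [Function.comp_apply, map_zsmul, tailSum_single, if_neg (hl.1 k hk).not_gt, smul_zero]

theorem prod_raiseOp_vacuum_reverse_finRange (s : Fin m → ℕ) :
    ((List.finRange m).reverse.map fun i => raiseOp i ^ s i).prod (Finsupp.single 0 1) =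
      Finsupp.single (fun i => (s i : ℤ)) 1 := by
  rw [prod_raiseOp_vacuum s _ (List.pairwise_reverse.2 (List.pairwise_lt_finRange m))]
  congr 1
  rw [List.map_reverse, List.sum_reverse, ← List.ofFn_eq_map, List.sum_ofFn]
  funext k
  simp [Finset.sum_apply, Pi.single_apply]

theorem isManin_one_by_one {B : Type*} [Ring B] [Algebra Zq B] (M : Matrix (Fin 1) (Fin 1) B) :
    IsManin M where
  comm h _ := by omega
  cross h _ := by omega
  row _ _ _ h := by omega
  col _ h := by omega

/-- The representation of the algebra for `m × (1 + n)` matrices constructed from the algebra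
for `m × n` matrices and the operators `columnOp`. -/
noncomputable def columnAction (m n : ℕ) :
    QMat m (1 + n) →ₐ[Zq] Module.End Zq (((Fin m → ℤ) →₀ Zq) ⊗[Zq] QMat m n) :=
  (Module.endTensorEndAlgHom.comp (Algebra.TensorProduct.map (AlgHom.id Zq _)
    (Algebra.lmul Zq (QMat m n)))).comp
  -- The quantum matrix used is the product of `columnOp`, of size `m × (1 + m)`, and `diag(1, X)`,
  -- of size `(1 + m) × (1 + n)`.
  (QMat.lift _ ((isManin_columnOp m).tmul
    ((isManin_one_by_one (1 : Matrix (Fin 1) (Fin 1) (QMat m n))).blockDiag (QMat.isManin_X m n)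
      fun i j k l => by
        rw [Subsingleton.elim i j, Matrix.one_apply_eq]
        exact Commute.one_left _)))

theorem columnAction_X_castAdd (i : Fin m) (j : Fin 1) (s : (Fin m → ℤ) →₀ Zq) (y : QMat m n) :
    columnAction m n (QMat.X _ _ i (Fin.castAdd n j)) (s ⊗ₜ y) = raiseOp i s ⊗ₜ y := by
  rw [columnAction, AlgHom.comp_apply, QMat.lift_X, Matrix.of_apply, ← finSumFinEquiv.sum_comp]
  simp [Module.endTensorEndAlgHom_apply, Subsingleton.elim j 0]

theorem columnAction_X_natAdd (i : Fin m) (j : Fin n) (s : (Fin m → ℤ) →₀ Zq) (y : QMat m n) :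
    columnAction m n (QMat.X _ _ i (Fin.natAdd 1 j)) (s ⊗ₜ y) =
      ∑ k, exchangeOp i k s ⊗ₜ (QMat.X m n k j * y) := by
  rw [columnAction, AlgHom.comp_apply, QMat.lift_X, Matrix.of_apply, ← finSumFinEquiv.sum_comp]
  simp [Module.endTensorEndAlgHom_apply]

/-- Since the exchange matrix is the identity on the vacuum, the later columns act on `e_0 ⊗ y` by
left multiplication on `y`. Products need the statement for every `y`. -/
theorem columnAction_embed_vacuum (z y : QMat m n) :
    columnAction m n (QMat.embed (RelEmbedding.refl _) (Fin.natAddOrderEmb 1) z)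
      (Finsupp.single 0 1 ⊗ₜ y) = Finsupp.single 0 1 ⊗ₜ (z * y) := by
  induction z using QMat.induction generalizing y with
  | hs r =>
    rw [AlgHom.commutes, AlgHom.commutes, Module.algebraMap_end_apply, ← Algebra.smul_def,
      TensorProduct.tmul_smul]
  | hX i j =>
    rw [QMat.embed, QMat.lift_X]
    refine (columnAction_X_natAdd i j _ y).trans ?_
    simp [exchangeOp_vacuum, TensorProduct.ite_tmul]
  | hm a b ha hb => rw [map_mul, map_mul, Module.End.mul_apply, hb, ha, mul_assoc]
  | ha a b ha hb => rw [map_add, map_add, LinearMap.add_apply, ha, hb, add_mul,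
      TensorProduct.tmul_add]

theorem columnAction_pow_castAdd (i : Fin m) (j : Fin 1) (k : ℕ) (s : (Fin m → ℤ) →₀ Zq)
    (y : QMat m n) :
    columnAction m n (QMat.X _ _ i (Fin.castAdd n j) ^ k) (s ⊗ₜ y) = (raiseOp i ^ k) s ⊗ₜ y := by
  induction k generalizing s with
  | zero => simp
  | succ k ih =>
    rw [pow_succ, map_mul, Module.End.mul_apply, columnAction_X_castAdd, ih, pow_succ,
      Module.End.mul_apply]

theorem columnAction_prod_castAdd (j : Fin 1) (a : Fin m → ℕ) (l : List (Fin m))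
    (s : (Fin m → ℤ) →₀ Zq) (y : QMat m n) :
    columnAction m n ((l.map fun i => QMat.X _ _ i (Fin.castAdd n j) ^ a i).prod) (s ⊗ₜ y) =
      (l.map fun i => raiseOp i ^ a i).prod s ⊗ₜ y := by
  induction l with
  | nil => simp
  | cons i l ih =>
    rw [List.map_cons, List.prod_cons, map_mul, Module.End.mul_apply, ih,
      columnAction_pow_castAdd, List.map_cons, List.prod_cons, Module.End.mul_apply]

/-- The later columns stand on the right of `x_A` and act first, through left multiplication on `1`.
The first column then records its exponents in the lattice. -/
theorem columnAction_monomial_vacuum (A : Matrix (Fin m) (Fin (1 + n)) ℕ) :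
    columnAction m n (monomial (QMat.X m (1 + n)) A) (Finsupp.single 0 1 ⊗ₜ 1) =
      Finsupp.single (fun i => (A i (Fin.castAdd n 0) : ℤ)) 1 ⊗ₜ
        monomial (QMat.X m n) (A.submatrix id (Fin.natAdd 1)) := by
  have h : monomial (QMat.X m (1 + n)) A =
      ((List.finRange m).reverse.map fun i =>
        QMat.X m (1 + n) i (Fin.castAdd n 0) ^ A i (Fin.castAdd n 0)).prod *
      QMat.embed (RelEmbedding.refl _) (Fin.natAddOrderEmb 1)
        (monomial (QMat.X m n) (A.submatrix id (Fin.natAdd 1))) := by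
    rw [QMat.embed, QMat.lift_monomial, monomial, prod_map_finRange_add]
    simp [monomial, List.finRange_succ]
  rw [h, map_mul, Module.End.mul_apply, columnAction_embed_vacuum, columnAction_prod_castAdd,
    prod_raiseOp_vacuum_reverse_finRange, mul_one]

end LinearIndependence

/-! ### The normally ordered monomials span -/

section Span

/-- `X i` moves to the right past the factors before `C i` and is absorbed there. It is applied both
to the rows of one column and to the columns. -/
theorem mul_prod_le_of_pairwise {R B α : Type*} [CommSemiring R] [Semiring B] [Algebra R B]
    (C X : α → Submodule R B) (l : List α) (h : ∀ i ∈ l, X i * C i ≤ C i)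
    (hl : l.Pairwise fun a b => X b * C a ≤ C a * X b) :
    ∀ i ∈ l, X i * (l.map C).prod ≤ (l.map C).prod := by
  induction l with
  | nil => simp
  | cons a l ih =>
    rw [List.pairwise_cons] at hl
    intro i hi
    rw [List.map_cons, List.prod_cons, ← mul_assoc]
    rcases List.mem_cons.1 hi with rfl | hi
    · exact mul_le_mul_left (h i (by simp)) _
    · refine (mul_le_mul_left (hl.1 i hi) _).trans ?_
      rw [mul_assoc]
      exact mul_le_mul_right (ih (fun i hi => h i (by simp [hi])) hl.2 i hi) _

/-- Without repetitions the exponents of different factors can be chosen independently. -/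
theorem prod_span_range_le {R B α K : Type*} [CommSemiring R] [Semiring B] [Algebra R B]
    [Nonempty K] (F : α → K → B) (l : List α) (hl : l.Nodup) :
    (l.map fun i => Submodule.span R (Set.range (F i))).prod ≤
      Submodule.span R (Set.range fun k : α → K => (l.map fun i => F i (k i)).prod) := by
  classical
  induction l with
  | nil =>
    rw [List.map_nil, List.prod_nil, Submodule.one_eq_span]
    refine Submodule.span_mono ?_
    simp [Set.range_const]
  | cons a l ih =>
    rw [List.nodup_cons] at hl
    rw [List.map_cons, List.prod_cons]
    refine (mul_le_mul_right (ih hl.2) _).trans ?_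
    rw [Submodule.span_mul_span]
    refine Submodule.span_mono ?_
    rintro _ ⟨_, ⟨k, rfl⟩, _, ⟨k', rfl⟩, rfl⟩
    refine ⟨Function.update k' a k, ?_⟩
    simp only [List.map_cons, List.prod_cons, Function.update_self]
    congr 2
    refine List.map_congr_left fun i hi => ?_
    rw [Function.update_of_ne]
    rintro rfl
    exact hl.1 hi

/-! ### Straightening within a column and between columns. -/

namespace QMat

variable {m n : ℕ}

/-- The span of the generators in column `j`. -/
noncomputable def columnSpan (m n : ℕ) (j : Fin n) : Submodule Zq (QMat m n) :=
  Submodule.span Zq (Set.range fun i => X m n i j)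

/-- The subalgebra generated by column `j`. -/
noncomputable def columnAlg (m n : ℕ) (j : Fin n) : Submodule Zq (QMat m n) :=
  Subalgebra.toSubmodule (Algebra.adjoin Zq (Set.range fun i => X m n i j))

/-- The span of the decreasingly ordered monomials in column `j`. -/
noncomputable def columnMonomials (m n : ℕ) (j : Fin n) : Submodule Zq (QMat m n) :=
  ((List.finRange m).reverse.map fun i =>
    Submodule.span Zq (Set.range fun k : ℕ => X m n i j ^ k)).prod

theorem columnSpan_le_columnAlg (j : Fin n) : columnSpan m n j ≤ columnAlg m n j :=
  Submodule.span_le.2 Algebra.subset_adjoin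

theorem columnAlg_mul_self (j : Fin n) : columnAlg m n j * columnAlg m n j = columnAlg m n j :=
  Subalgebra.isIdempotentElem_toSubmodule _

theorem X_mul_pow_of_lt {i k : Fin m} (j : Fin n) (h : i < k) (t : ℕ) :
    X m n i j * X m n k j ^ t = q ^ t • (X m n k j ^ t * X m n i j) := by
  induction t with
  | zero => simp
  | succ t ih =>
    rw [pow_succ, ← mul_assoc, ih, smul_mul_assoc, mul_assoc, (isManin_X m n).col j h,
      mul_smul_comm, smul_smul, mul_assoc, pow_succ]

/-- A generator `q`-commutes past the powers of generators in larger rows until it reaches the power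
of itself. -/
theorem columnSpan_mul_columnMonomials_le (j : Fin n) :
    columnSpan m n j * columnMonomials m n j ≤ columnMonomials m n j := by
  refine Submodule.mul_le.2 fun x hx y hy => ?_
  induction hx using Submodule.span_induction with
  | mem x hx =>
    obtain ⟨i, rfl⟩ := hx
    refine mul_prod_le_of_pairwise (R := Zq) _ (fun i => Submodule.span Zq {X m n i j})
      (List.finRange m).reverse (fun i _ => ?_) ?_ i (by simp)
      (Submodule.mul_mem_mul (Submodule.mem_span_singleton_self _) hy)
    · rw [Submodule.span_mul_span]
      refine Submodule.span_mono ?_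
      rintro _ ⟨_, rfl, _, ⟨k, rfl⟩, rfl⟩
      exact ⟨k + 1, pow_succ' _ _⟩
    · refine (List.pairwise_reverse.2 (List.pairwise_lt_finRange m)).imp fun {a b} hab => ?_
      rw [Submodule.span_mul_span, Submodule.span_le]
      rintro _ ⟨_, rfl, _, ⟨k, rfl⟩, rfl⟩
      change X m n b j * X m n a j ^ k ∈ _
      rw [X_mul_pow_of_lt j hab]
      exact Submodule.smul_mem _ _ (Submodule.mul_mem_mul
        (Submodule.subset_span ⟨k, rfl⟩) (Submodule.mem_span_singleton_self _))
  | zero => simp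
  | add x x' _ _ h h' => simpa only [add_mul] using add_mem h h'
  | smul r x _ h => simpa only [smul_mul_assoc] using Submodule.smul_mem _ r h

theorem one_mem_prod {R B : Type*} [CommSemiring R] [Semiring B] [Algebra R B]
    (l : List (Submodule R B)) (h : ∀ P ∈ l, (1 : B) ∈ P) : (1 : B) ∈ l.prod := by
  induction l with
  | nil => exact Submodule.one_le.1 le_rfl
  | cons P l ih =>
    rw [List.prod_cons]
    simpa using Submodule.mul_mem_mul (h P (by simp)) (ih fun P hP => h P (by simp [hP]))

/-- The ordered monomials contain `1`, and their span is stable under left multiplication by the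
generators of the column. -/
theorem columnAlg_le_columnMonomials (j : Fin n) : columnAlg m n j ≤ columnMonomials m n j := by
  have key : ∀ x ∈ columnAlg m n j, ∀ y ∈ columnMonomials m n j,
      x * y ∈ columnMonomials m n j := by
    intro x hx
    induction hx using Algebra.adjoin_induction with
    | mem x hx =>
      exact fun y hy => columnSpan_mul_columnMonomials_le j
        (Submodule.mul_mem_mul (Submodule.subset_span hx) hy)
    | algebraMap r =>
      intro y hy
      rw [← Algebra.smul_def]
      exact Submodule.smul_mem _ _ hy
    | add x x' _ _ h h' =>
      exact fun y hy => by simpa only [add_mul] using add_mem (h y hy) (h' y hy)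
    | mul x x' _ _ h h' => exact fun y hy => by simpa only [mul_assoc] using h _ (h' y hy)
  intro x hx
  have h1 : (1 : QMat m n) ∈ columnMonomials m n j := by
    refine one_mem_prod _ fun P hP => ?_
    obtain ⟨i, _, rfl⟩ := List.mem_map.1 hP
    exact Submodule.subset_span ⟨0, pow_zero _⟩
  simpa using key x hx 1 h1

/-- The correction term of the cross relation again has column `l` before column `j`. Its rows are
exchanged, so the span of a whole column is moved, not a single generator. -/
theorem columnSpan_mul_columnAlg_le {j l : Fin n} (h : l < j) :
    columnSpan m n j * columnAlg m n l ≤ columnAlg m n l * columnSpan m n j := by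
  have key : ∀ y ∈ columnAlg m n l, ∀ x ∈ columnSpan m n j,
      x * y ∈ columnAlg m n l * columnSpan m n j := by
    intro y hy
    induction hy using Algebra.adjoin_induction with
    | mem y hy =>
      obtain ⟨k, rfl⟩ := hy
      have hmem : ∀ i k, X m n k l * X m n i j ∈ columnAlg m n l * columnSpan m n j := fun i k =>
        Submodule.mul_mem_mul (Algebra.subset_adjoin ⟨k, rfl⟩) (Submodule.subset_span ⟨i, rfl⟩)
      intro x hx
      induction hx using Submodule.span_induction with
      | mem x hx =>
        obtain ⟨i, rfl⟩ := hx
        change X m n i j * X m n k l ∈ _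
        rcases lt_trichotomy i k with hik | rfl | hik
        · rw [(isManin_X m n).comm hik h]
          exact hmem _ _
        · rw [(isManin_X m n).row i h]
          exact Submodule.smul_mem _ _ (hmem _ _)
        · rw [(isManin_X m n).cross hik h]
          exact sub_mem (hmem _ _) (Submodule.smul_mem _ _ (hmem _ _))
      | zero => simp
      | add x x' _ _ h h' => simpa only [add_mul] using add_mem h h'
      | smul r x _ h => simpa only [smul_mul_assoc] using Submodule.smul_mem _ r h
    | algebraMap r =>
      intro x hx
      rw [← Algebra.commutes]
      exact Submodule.mul_mem_mul (Subalgebra.algebraMap_mem _ r) hx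
    | add y y' _ _ h h' =>
      exact fun x hx => by simpa only [mul_add] using add_mem (h x hx) (h' x hx)
    | mul y y' _ _ h h' =>
      intro x hx
      -- With `A` the algebra of column `l` and `S` the span of column `j`: `x y y' ∈ A S y' ⊆ A A S
      -- = A S`.
      have h₁ : columnSpan m n j * Submodule.span Zq {y'} ≤
          columnAlg m n l * columnSpan m n j := by
        refine Submodule.mul_le.2 fun z hz w hw => ?_
        obtain ⟨r, rfl⟩ := Submodule.mem_span_singleton.1 hw
        rw [mul_smul_comm]
        exact Submodule.smul_mem _ _ (h' z hz)
      have h₂ : columnAlg m n l * columnSpan m n j * Submodule.span Zq {y'} ≤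
          columnAlg m n l * columnSpan m n j := by
        rw [mul_assoc]
        refine (mul_le_mul_right h₁ _).trans ?_
        rw [← mul_assoc, columnAlg_mul_self]
      rw [← mul_assoc]
      exact h₂ (Submodule.mul_mem_mul (h x hx) (Submodule.mem_span_singleton_self _))
  exact Submodule.mul_le.2 fun x hx y hy => key y hy x hx

theorem prod_columnAlg_eq_top (m n : ℕ) : ((List.finRange n).map (columnAlg m n)).prod = ⊤ := by
  have h1 : (1 : QMat m n) ∈ ((List.finRange n).map (columnAlg m n)).prod := by
    refine one_mem_prod _ fun P hP => ?_
    obtain ⟨j, _, rfl⟩ := List.mem_map.1 hP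
    exact one_mem (Algebra.adjoin Zq (Set.range fun i => X m n i j))
  have key : ∀ x : QMat m n, ∀ y ∈ ((List.finRange n).map (columnAlg m n)).prod,
      x * y ∈ ((List.finRange n).map (columnAlg m n)).prod := by
    intro x
    induction x using QMat.induction with
    | hs r =>
      intro y hy
      rw [← Algebra.smul_def]
      exact Submodule.smul_mem _ _ hy
    | hX i j =>
      intro y hy
      refine mul_prod_le_of_pairwise _ (columnSpan m n) (List.finRange n) (fun j _ => ?_)
        ((List.pairwise_lt_finRange n).imp columnSpan_mul_columnAlg_le) j (List.mem_finRange j)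
        (Submodule.mul_mem_mul (Submodule.subset_span ⟨i, rfl⟩) hy)
      exact (mul_le_mul_left (columnSpan_le_columnAlg j) _).trans (columnAlg_mul_self j).le
    | hm x x' h h' => exact fun y hy => by simpa only [mul_assoc] using h _ (h' y hy)
    | ha x x' h h' => exact fun y hy => by simpa only [add_mul] using add_mem (h y hy) (h' y hy)
  exact eq_top_iff.2 fun x _ => by simpa using key x 1 h1

theorem span_monomial_eq_top (m n : ℕ) :
    Submodule.span Zq (Set.range (monomial (X m n))) = ⊤ := by
  have hC : ∀ j, columnAlg m n j ≤ Submodule.span Zq (Set.range fun k : Fin m → ℕ =>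
      ((List.finRange m).reverse.map fun i => X m n i j ^ k i).prod) := fun j =>
    (columnAlg_le_columnMonomials j).trans
      (prod_span_range_le (fun i (k : ℕ) => X m n i j ^ k) _
        (List.nodup_reverse.2 (List.nodup_finRange m)))
  rw [eq_top_iff, ← prod_columnAlg_eq_top m n]
  refine (List.Forall₂.prod_le_prod' ?_).trans
    ((prod_span_range_le (fun j (k : Fin m → ℕ) =>
      ((List.finRange m).reverse.map fun i => X m n i j ^ k i).prod) (List.finRange n)
        (List.nodup_finRange n)).trans (Submodule.span_mono ?_))
  · simp only [List.forall₂_map_left_iff, List.forall₂_map_right_iff]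
    exact List.forall₂_same.2 fun j _ => hC j
  · rintro _ ⟨k, rfl⟩
    exact ⟨Matrix.of fun i j => k j i, rfl⟩

theorem linearIndependent_monomial (m n : ℕ) : LinearIndependent Zq (monomial (X m n)) := by
  induction n with
  | zero =>
    -- Without columns there are no generators, and the only monomial `1` has image `1` in the
    -- ground ring.
    have hM : IsManin (0 : Matrix (Fin m) (Fin 0) Zq) :=
      ⟨fun {_ j} => j.elim0, fun {_ j} => j.elim0, fun _ j => j.elim0, fun j => j.elim0⟩
    let _ : Unique (Matrix (Fin m) (Fin 0) ℕ) := ⟨⟨0⟩, fun A => Matrix.ext fun _ j => j.elim0⟩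
    refine LinearIndependent.of_comp (lift _ hM).toLinearMap (linearIndependent_unique_iff.2 ?_)
    simp [monomial]
  | succ n ih =>
    rw [add_comm n 1]
    let b : Module.Basis (Matrix (Fin m) (Fin n) ℕ) Zq (QMat m n) :=
      Module.Basis.mk ih (span_monomial_eq_top m n).ge
    -- Evaluation of the action at `e_0 ⊗ 1` maps the normal monomials injectively into a basis.
    let φ : QMat m (1 + n) →ₗ[Zq] ((Fin m → ℤ) →₀ Zq) ⊗[Zq] QMat m n :=
      (LinearMap.applyₗ (Finsupp.single 0 1 ⊗ₜ 1)).comp (columnAction m n).toLinearMap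
    refine LinearIndependent.of_comp φ ?_
    let g : Matrix (Fin m) (Fin (1 + n)) ℕ → (Fin m → ℤ) × Matrix (Fin m) (Fin n) ℕ := fun A =>
      (fun i => (A i (Fin.castAdd n 0) : ℤ), A.submatrix id (Fin.natAdd 1))
    have hg : Function.Injective g := by
      intro A A' h
      ext i j
      induction j using Fin.addCases with
      | left j =>
        rw [Subsingleton.elim j 0]
        exact Int.ofNat_inj.1 (congrFun (congrArg Prod.fst h) i)
      | right j => exact congrFun (congrFun (congrArg Prod.snd h) i) j
    let b' := (Finsupp.basisSingleOne (R := Zq) (ι := Fin m → ℤ)).tensorProduct b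
    have h : φ ∘ monomial (X m (1 + n)) = b' ∘ g := by
      funext A
      refine (columnAction_monomial_vacuum A).trans ?_
      simp [b', b, g]
    rw [h]
    exact b'.linearIndependent.comp g hg

/-- The basis of normally ordered monomials. -/
noncomputable def basis (m n : ℕ) : Module.Basis (Matrix (Fin m) (Fin n) ℕ) Zq (QMat m n) :=
  Module.Basis.mk (linearIndependent_monomial m n) (span_monomial_eq_top m n).ge

@[simp]
theorem basis_apply (A : Matrix (Fin m) (Fin n) ℕ) : basis m n A = monomial (X m n) A :=
  Module.Basis.mk_apply _ _ _

end QMat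

end Span

/-! ### Convolution and tensor product of functionals -/

section Dual

open TensorProduct

theorem dualDistrib_comp {R M N M' N' : Type*} [CommSemiring R] [AddCommMonoid M]
    [AddCommMonoid N] [AddCommMonoid M'] [AddCommMonoid N'] [Module R M] [Module R N] [Module R M']
    [Module R N'] (f : Module.Dual R M') (g : Module.Dual R N') (φ : M →ₗ[R] M') (ψ : N →ₗ[R] N')
    (y : M ⊗[R] N) :
    dualDistrib R M N ((f ∘ₗ φ) ⊗ₜ (g ∘ₗ ψ)) y = dualDistrib R M' N' (f ⊗ₜ g) (map φ ψ y) := by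
  induction y with
  | zero => simp
  | tmul a b => simp
  | add a b ha hb => simp only [map_add, ha, hb]

theorem dualDistrib_assoc {R M N P : Type*} [CommSemiring R] [AddCommMonoid M]
    [AddCommMonoid N] [AddCommMonoid P] [Module R M] [Module R N] [Module R P]
    (f : Module.Dual R M) (g : Module.Dual R N) (h : Module.Dual R P) (y : (M ⊗[R] N) ⊗[R] P) :
    dualDistrib R _ _ (dualDistrib R M N (f ⊗ₜ g) ⊗ₜ h) y =
      dualDistrib R _ _ (f ⊗ₜ dualDistrib R N P (g ⊗ₜ h)) (TensorProduct.assoc R M N P y) := by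
  induction y with
  | zero => simp
  | tmul a c =>
    induction a with
    | zero => simp
    | tmul a b => simp [mul_assoc]
    | add a b ha hb => simp only [add_tmul, map_add, ha, hb]
  | add a b ha hb => simp only [map_add, ha, hb]

theorem dualDistrib_tensorTensorTensorComm {R M N P Q : Type*} [CommSemiring R] [AddCommMonoid M]
    [AddCommMonoid N] [AddCommMonoid P] [AddCommMonoid Q] [Module R M] [Module R N] [Module R P]
    [Module R Q] (f : Module.Dual R M) (g : Module.Dual R N) (h : Module.Dual R P)
    (k : Module.Dual R Q) (y : (M ⊗[R] N) ⊗[R] (P ⊗[R] Q)) :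
    dualDistrib R _ _ (dualDistrib R M P (f ⊗ₜ h) ⊗ₜ dualDistrib R N Q (g ⊗ₜ k))
      (tensorTensorTensorComm R M N P Q y) =
    dualDistrib R _ _ (dualDistrib R M N (f ⊗ₜ g) ⊗ₜ dualDistrib R P Q (h ⊗ₜ k)) y := by
  induction y with
  | zero => simp
  | tmul a c =>
    induction a with
    | zero => simp
    | tmul a b =>
      induction c with
      | zero => simp
      | tmul c d => simp [mul_assoc, mul_left_comm]
      | add c d hc hd => simp only [tmul_add, map_add, hc, hd]
    | add a b ha hb => simp only [add_tmul, map_add, ha, hb]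
  | add a b ha hb => simp only [map_add, ha, hb]

/-! ### Composition, identities and tensor products of functionals. -/

namespace QMat

variable {k l m n a b c d : ℕ}

/-- The convolution of functionals, dual to the comultiplication. -/
noncomputable def conv (f : Module.Dual Zq (QMat l m)) (g : Module.Dual Zq (QMat m n)) :
    Module.Dual Zq (QMat l n) :=
  dualDistrib Zq _ _ (f ⊗ₜ g) ∘ₗ (comul l m n).toLinearMap

theorem conv_apply (f : Module.Dual Zq (QMat l m)) (g : Module.Dual Zq (QMat m n))
    (y : QMat l n) : conv f g y = dualDistrib Zq _ _ (f ⊗ₜ g) (comul l m n y) :=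
  rfl

theorem conv_add (f : Module.Dual Zq (QMat l m)) (g g' : Module.Dual Zq (QMat m n)) :
    conv f (g + g') = conv f g + conv f g' := by
  simp only [conv, tmul_add, map_add, LinearMap.add_comp]

theorem add_conv (f f' : Module.Dual Zq (QMat l m)) (g : Module.Dual Zq (QMat m n)) :
    conv (f + f') g = conv f g + conv f' g := by
  simp only [conv, add_tmul, map_add, LinearMap.add_comp]

theorem conv_smul (r : Zq) (f : Module.Dual Zq (QMat l m)) (g : Module.Dual Zq (QMat m n)) :
    conv f (r • g) = r • conv f g := by
  simp only [conv, tmul_smul, map_smul, LinearMap.smul_comp]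

theorem smul_conv (r : Zq) (f : Module.Dual Zq (QMat l m)) (g : Module.Dual Zq (QMat m n)) :
    conv (r • f) g = r • conv f g := by
  simp only [conv, ← smul_tmul', map_smul, LinearMap.smul_comp]

/-- Dual to `comul_coassoc`. -/
theorem conv_assoc (f : Module.Dual Zq (QMat k l)) (g : Module.Dual Zq (QMat l m))
    (h : Module.Dual Zq (QMat m n)) : conv (conv f g) h = conv f (conv g h) := by
  refine LinearMap.ext fun y => ?_
  rw [conv_apply, conv_apply]
  have h₁ := dualDistrib_comp (dualDistrib Zq _ _ (f ⊗ₜ g)) h (comul k l m).toLinearMap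
    LinearMap.id (comul k m n y)
  have h₂ := dualDistrib_comp f (dualDistrib Zq _ _ (g ⊗ₜ h)) LinearMap.id
    (comul l m n).toLinearMap (comul k l n y)
  refine h₁.trans ((dualDistrib_assoc _ _ _ _).trans (Eq.trans ?_ h₂.symm))
  congr 1
  exact DFunLike.congr_fun (comul_coassoc k l m n) y

/-- The functional extracting the coefficient of a monomial after restriction to the torus. -/
noncomputable def weight (s : Fin n → ℕ) : Module.Dual Zq (QMat n n) :=
  MvPolynomial.lcoeff Zq (Finsupp.equivFunOnFinite.symm s) ∘ₗ (torus n).toLinearMap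

theorem weight_one (s : Fin 0 → ℕ) : weight s 1 = 1 := by
  rw [weight, LinearMap.comp_apply, AlgHom.toLinearMap_apply, map_one, MvPolynomial.lcoeff_apply,
    MvPolynomial.coeff_one, if_pos (Subsingleton.elim _ _)]

/-- By `torus_comul_left`, the left factor only tests whether the exponent of the torus monomial is
`s`. -/
theorem weight_conv_monomial (s : Fin m → ℕ) (f : Module.Dual Zq (QMat m n))
    (A : Matrix (Fin m) (Fin n) ℕ) : conv (weight s) f (monomial (X m n) A) =
      if (fun i => ∑ j, A i j) = s then f (monomial (X m n) A) else 0 := by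
  have h := dualDistrib_comp (MvPolynomial.lcoeff Zq (Finsupp.equivFunOnFinite.symm s)) f
    (torus m).toLinearMap LinearMap.id (comul m m n (monomial (X m n) A))
  refine h.trans ?_
  have h' := torus_comul_left A
  rw [show TensorProduct.map (torus m).toLinearMap LinearMap.id
    (comul m m n (monomial (X m n) A)) = _ from h', dualDistrib_apply, MvPolynomial.lcoeff_apply,
    MvPolynomial.coeff_monomial]
  simp only [EmbeddingLike.apply_eq_iff_eq, ite_mul, one_mul, zero_mul]

theorem conv_weight_monomial (f : Module.Dual Zq (QMat m n)) (t : Fin n → ℕ)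
    (A : Matrix (Fin m) (Fin n) ℕ) : conv f (weight t) (monomial (X m n) A) =
      if (fun j => ∑ i, A i j) = t then f (monomial (X m n) A) else 0 := by
  have h := dualDistrib_comp f (MvPolynomial.lcoeff Zq (Finsupp.equivFunOnFinite.symm t))
    LinearMap.id (torus n).toLinearMap (comul m n n (monomial (X m n) A))
  refine h.trans ?_
  have h' := torus_comul_right A
  rw [show TensorProduct.map LinearMap.id (torus n).toLinearMap
    (comul m n n (monomial (X m n) A)) = _ from h', dualDistrib_apply, MvPolynomial.lcoeff_apply,
    MvPolynomial.coeff_monomial]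
  simp only [EmbeddingLike.apply_eq_iff_eq, mul_ite, mul_one, mul_zero]

theorem coord_monomial (A B : Matrix (Fin m) (Fin n) ℕ) :
    (basis m n).coord A (monomial (X m n) B) = if B = A then 1 else 0 := by
  rw [← basis_apply, Module.Basis.coord_apply, Module.Basis.repr_self, Finsupp.single_apply]

/-- The torus kills monomials of non-diagonal matrices and separates those of diagonal ones. The
torus form gives the identity laws, the coordinate form identifies the identity in the basis. -/
theorem weight_eq_coord (s : Fin n → ℕ) :
    weight s = (basis n n).coord (Matrix.diagonal s) := by
  refine (basis n n).ext fun E => ?_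
  rw [basis_apply, coord_monomial, weight, LinearMap.comp_apply, AlgHom.toLinearMap_apply]
  by_cases hE : ∃ t, E = Matrix.diagonal t
  · obtain ⟨t, rfl⟩ := hE
    rw [torus_monomial_diagonal, MvPolynomial.lcoeff_apply, MvPolynomial.coeff_monomial]
    simp only [EmbeddingLike.apply_eq_iff_eq, Matrix.diagonal_injective.eq_iff]
  · push Not at hE
    rw [torus_monomial_of_ne E hE, map_zero, if_neg (hE s)]

/-- The tensor product of functionals, dual to the projection to two diagonal blocks. -/
noncomputable def tensor (f : Module.Dual Zq (QMat a c)) (g : Module.Dual Zq (QMat b d)) :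
    Module.Dual Zq (QMat (a + b) (c + d)) :=
  dualDistrib Zq _ _ (f ⊗ₜ g) ∘ₗ (blockProj a b c d).toLinearMap

theorem tensor_apply (f : Module.Dual Zq (QMat a c)) (g : Module.Dual Zq (QMat b d))
    (y : QMat (a + b) (c + d)) :
    tensor f g y = dualDistrib Zq _ _ (f ⊗ₜ g) (blockProj a b c d y) :=
  rfl

theorem tensor_add (f : Module.Dual Zq (QMat a c)) (g g' : Module.Dual Zq (QMat b d)) :
    tensor f (g + g') = tensor f g + tensor f g' := by
  simp only [tensor, tmul_add, map_add, LinearMap.add_comp]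

theorem add_tensor (f f' : Module.Dual Zq (QMat a c)) (g : Module.Dual Zq (QMat b d)) :
    tensor (f + f') g = tensor f g + tensor f' g := by
  simp only [tensor, add_tmul, map_add, LinearMap.add_comp]

theorem tensor_smul (r : Zq) (f : Module.Dual Zq (QMat a c)) (g : Module.Dual Zq (QMat b d)) :
    tensor f (r • g) = r • tensor f g := by
  simp only [tensor, tmul_smul, map_smul, LinearMap.smul_comp]

theorem smul_tensor (r : Zq) (f : Module.Dual Zq (QMat a c)) (g : Module.Dual Zq (QMat b d)) :
    tensor (r • f) g = r • tensor f g := by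
  simp only [tensor, ← smul_tmul', map_smul, LinearMap.smul_comp]

/-- `blockProj` sends each normal monomial either to a pure tensor of normal monomials or to zero.
-/
theorem tensor_coord (A : Matrix (Fin a) (Fin c) ℕ) (A' : Matrix (Fin b) (Fin d) ℕ) :
    tensor ((basis a c).coord A) ((basis b d).coord A') =
      (basis (a + b) (c + d)).coord (blockDiag A A') := by
  refine (basis _ _).ext fun E => ?_
  rw [basis_apply, coord_monomial, tensor_apply]
  by_cases hE : ∃ B B', E = blockDiag B B'
  · obtain ⟨B, B', rfl⟩ := hE
    rw [blockProj_monomial_blockDiag, dualDistrib_apply, coord_monomial, coord_monomial,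
      ite_zero_mul_ite_zero, mul_one]
    simp only [blockDiag_inj]
  · push Not at hE
    rw [blockProj_monomial_of_ne E hE, map_zero, if_neg (hE A A')]

theorem blockDiag_diagonal (s : Fin a → ℕ) (t : Fin b → ℕ) :
    blockDiag (Matrix.diagonal s) (Matrix.diagonal t) = Matrix.diagonal (Fin.append s t) := by
  ext i j
  induction i using Fin.addCases <;> induction j using Fin.addCases <;>
    simp [Matrix.diagonal_apply, Fin.ext_iff] <;> omega

theorem tensor_weight (s : Fin a → ℕ) (t : Fin b → ℕ) :
    tensor (weight s) (weight t) = weight (Fin.append s t) := by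
  rw [weight_eq_coord, weight_eq_coord, weight_eq_coord, tensor_coord, blockDiag_diagonal]

/-- Dual to `comul_blockProj`; the middle two tensor factors are exchanged. -/
theorem conv_tensor {e e' : ℕ} (f : Module.Dual Zq (QMat a c)) (g : Module.Dual Zq (QMat b d))
    (f' : Module.Dual Zq (QMat c e)) (g' : Module.Dual Zq (QMat d e')) :
    conv (tensor f g) (tensor f' g') = tensor (conv f f') (conv g g') := by
  refine LinearMap.ext fun y => ?_
  have h₁ := dualDistrib_comp (dualDistrib Zq _ _ (f ⊗ₜ g)) (dualDistrib Zq _ _ (f' ⊗ₜ g'))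
    (blockProj a b c d).toLinearMap (blockProj c d e e').toLinearMap (comul _ _ _ y)
  have h₂ := dualDistrib_comp (dualDistrib Zq _ _ (f ⊗ₜ f')) (dualDistrib Zq _ _ (g ⊗ₜ g'))
    (comul a c e).toLinearMap (comul b d e').toLinearMap (blockProj _ _ _ _ y)
  refine h₁.trans (Eq.trans ?_ h₂.symm)
  rw [← dualDistrib_tensorTensorTensorComm f f' g g']
  congr 1
  exact DFunLike.congr_fun (comul_blockProj a b c d e e') y

/-- The isomorphism corresponding to equalities of the sizes. -/
noncomputable def reindex (h : a = b) (h' : c = d) : QMat a c →ₐ[Zq] QMat b d :=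
  embed (Fin.castOrderIso h).toOrderEmbedding (Fin.castOrderIso h').toOrderEmbedding

theorem reindex_X (h : a = b) (h' : c = d) (i : Fin a) (j : Fin c) :
    reindex h h' (X a c i j) = X b d (Fin.cast h i) (Fin.cast h' j) := by
  rw [reindex, embed, lift_X]
  rfl

theorem reindex_rfl : reindex (rfl : a = a) (rfl : b = b) = AlgHom.id Zq (QMat a b) :=
  hom_ext fun i j => reindex_X _ _ i j

/-- Both sides extract three diagonal blocks; `reindex` identifies the index types `a + b + c` and
`a + (b + c)`. -/
theorem blockProj_assoc (a b c a' b' c' : ℕ) :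
    (Algebra.TensorProduct.assoc Zq Zq Zq _ _ _).toAlgHom.comp
      ((Algebra.TensorProduct.map (blockProj a b a' b') (AlgHom.id Zq (QMat c c'))).comp
        (blockProj (a + b) c (a' + b') c')) =
    ((Algebra.TensorProduct.map (AlgHom.id Zq (QMat a a')) (blockProj b c b' c')).comp
        (blockProj a (b + c) a' (b' + c'))).comp
      (reindex (add_assoc a b c) (add_assoc a' b' c')) := by
  have h₁ : ∀ (a b c : ℕ) (h : a + b + c = a + (b + c)) (i : Fin a),
    Fin.cast h (Fin.castAdd c (Fin.castAdd b i)) = Fin.castAdd (b + c) i := fun _ _ _ _ _ => rfl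
  have h₂ : ∀ (a b c : ℕ) (h : a + b + c = a + (b + c)) (i : Fin b),
    Fin.cast h (Fin.castAdd c (Fin.natAdd a i)) = Fin.natAdd a (Fin.castAdd c i) :=
      fun _ _ _ _ _ => rfl
  have h₃ : ∀ (a b c : ℕ) (h : a + b + c = a + (b + c)) (i : Fin c),
    Fin.cast h (Fin.natAdd (a + b) i) = Fin.natAdd a (Fin.natAdd b i) :=
      fun _ _ _ _ _ => Fin.ext (by simp [add_assoc])
  refine hom_ext fun i j => ?_
  simp only [AlgHom.comp_apply, reindex_X, blockProj_X, blockX]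
  induction i using Fin.addCases with
  | left i =>
    induction i using Fin.addCases <;>
    · induction j using Fin.addCases with
      | left j =>
        induction j using Fin.addCases <;>
          simp [h₁, h₂, blockProj_X, blockX, Algebra.TensorProduct.one_def]
      | right j => simp [h₁, h₂, h₃, blockProj_X, blockX]
  | right i =>
    induction j using Fin.addCases with
    | left j =>
      induction j using Fin.addCases <;>
        simp [h₁, h₂, h₃, blockProj_X, blockX]
    | right j => simp [h₃, blockProj_X, blockX, Algebra.TensorProduct.one_def]

theorem tensor_assoc {a' b' c' : ℕ} (f : Module.Dual Zq (QMat a a'))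
    (g : Module.Dual Zq (QMat b b')) (h : Module.Dual Zq (QMat c c'))
    (y : QMat (a + b + c) (a' + b' + c')) :
    tensor (tensor f g) h y =
      tensor f (tensor g h) (reindex (add_assoc a b c) (add_assoc a' b' c') y) := by
  have h₁ := dualDistrib_comp (dualDistrib Zq _ _ (f ⊗ₜ g)) h (blockProj a b a' b').toLinearMap
    LinearMap.id (blockProj _ _ _ _ y)
  have h₂ := dualDistrib_comp f (dualDistrib Zq _ _ (g ⊗ₜ h)) LinearMap.id
    (blockProj b c b' c').toLinearMap (blockProj _ _ _ _ (reindex (add_assoc a b c)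
      (add_assoc a' b' c') y))
  refine h₁.trans ((dualDistrib_assoc _ _ _ _).trans (Eq.trans ?_ h₂.symm))
  congr 1
  exact DFunLike.congr_fun (blockProj_assoc a b c a' b' c') y

/-- With an empty first block, `blockProj` is `y ↦ 1 ⊗ y` up to reindexing, and `weight s 1 = 1`. -/
theorem weight_tensor (s : Fin 0 → ℕ) (f : Module.Dual Zq (QMat a b)) (y : QMat (0 + a) (0 + b)) :
    tensor (weight s) f y = f (reindex (zero_add a) (zero_add b) y) := by
  have h : blockProj 0 a 0 b = (Algebra.TensorProduct.includeRight :
      _ →ₐ[Zq] QMat 0 0 ⊗[Zq] QMat a b).comp (reindex (zero_add a) (zero_add b)) := by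
    refine hom_ext fun i j => ?_
    rw [AlgHom.comp_apply, reindex_X, blockProj_X, blockX]
    induction i using Fin.addCases with
    | left i => exact i.elim0
    | right i =>
      induction j using Fin.addCases with
      | left j => exact j.elim0
      | right j =>
        rw [blockDiag_natAdd_natAdd, Matrix.of_apply, Algebra.TensorProduct.includeRight_apply]
        congr 2 <;> exact Fin.ext (by simp)
  rw [tensor_apply, h, AlgHom.comp_apply, Algebra.TensorProduct.includeRight_apply,
    dualDistrib_apply, weight_one, one_mul]

theorem tensor_weight_zero (s : Fin 0 → ℕ) (f : Module.Dual Zq (QMat a b))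
    (y : QMat (a + 0) (b + 0)) :
    tensor f (weight s) y = f (reindex (add_zero a) (add_zero b) y) := by
  have h : blockProj a 0 b 0 = (Algebra.TensorProduct.includeLeft :
      _ →ₐ[Zq] QMat a b ⊗[Zq] QMat 0 0).comp (reindex (add_zero a) (add_zero b)) := by
    refine hom_ext fun i j => ?_
    rw [AlgHom.comp_apply, reindex_X, blockProj_X, blockX]
    induction i using Fin.addCases with
    | left i =>
      induction j using Fin.addCases with
      | left j => exact blockDiag_castAdd_castAdd _ _ i j
      | right j => exact j.elim0
    | right i => exact i.elim0
  rw [tensor_apply, h, AlgHom.comp_apply, Algebra.TensorProduct.includeLeft_apply,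
    dualDistrib_apply, weight_one, mul_one]

theorem coord_zeroExtend (f : Fin a ↪o Fin m) (g : Fin b ↪o Fin n)
    (A : Matrix (Fin a) (Fin b) ℕ) :
    (basis m n).coord (zeroExtend f g A) = (basis a b).coord A ∘ₗ (retract f g).toLinearMap := by
  refine (basis m n).ext fun E => ?_
  rw [basis_apply, coord_monomial, LinearMap.comp_apply, AlgHom.toLinearMap_apply]
  by_cases hE : ∃ B, E = zeroExtend f g B
  · obtain ⟨B, rfl⟩ := hE
    rw [retract_monomial_zeroExtend, coord_monomial]
    simp only [(zeroExtend_injective f g).eq_iff]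
  · push Not at hE
    rw [retract_monomial_of_ne f g E hE, map_zero, if_neg (hE A)]

/-- Padded coordinates factor through `retract` and padded monomials come from `embed`, so
`retract_comul_embed` applies. -/
theorem conv_coord_zeroExtend (f : Fin a ↪o Fin l) (g : Fin b ↪o Fin m) (h : Fin c ↪o Fin n)
    (A : Matrix (Fin a) (Fin b) ℕ) (B : Matrix (Fin b) (Fin c) ℕ)
    (C : Matrix (Fin a) (Fin c) ℕ) :
    conv ((basis l m).coord (zeroExtend f g A)) ((basis m n).coord (zeroExtend g h B))
      (monomial (X l n) (zeroExtend f h C)) =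
    conv ((basis a b).coord A) ((basis b c).coord B) (monomial (X a c) C) := by
  rw [conv_apply, coord_zeroExtend, coord_zeroExtend, ← embed_monomial, dualDistrib_comp,
    conv_apply, ← retract_comul_embed f g h]
  rfl

end QMat

end Dual

/-! ### The morphism spaces -/

section HomSpace

open QMat

variable {k l m n a b c d : ℕ}

/-- The functionals of given row and column weight. -/
noncomputable def homSpace (s : Fin m → ℕ) (t : Fin n → ℕ) :
    Submodule Zq (Module.Dual Zq (QMat m n)) where
  carrier := {f | conv (weight s) f = f ∧ conv f (weight t) = f}
  add_mem' hf hg := ⟨by rw [conv_add, hf.1, hg.1], by rw [add_conv, hf.2, hg.2]⟩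
  zero_mem' := ⟨by simpa using conv_smul 0 (weight s) 0, by simpa using smul_conv 0 0 (weight t)⟩
  smul_mem' r f hf := ⟨by rw [conv_smul, hf.1], by rw [smul_conv, hf.2]⟩

theorem conv_mem_homSpace {s : Fin l → ℕ} {t : Fin m → ℕ} {u : Fin n → ℕ}
    {f : Module.Dual Zq (QMat l m)} {g : Module.Dual Zq (QMat m n)} (hf : f ∈ homSpace s t)
    (hg : g ∈ homSpace t u) : conv f g ∈ homSpace s u :=
  ⟨by rw [← conv_assoc, hf.1], by rw [conv_assoc, hg.2]⟩

/-- Convolution with the two weights erases exactly the values at monomials with other row or column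
sums. -/
theorem mem_homSpace_iff {s : Fin m → ℕ} {t : Fin n → ℕ} {f : Module.Dual Zq (QMat m n)} :
    f ∈ homSpace s t ↔ ∀ A : Matrix (Fin m) (Fin n) ℕ,
      ¬ ((∀ i, ∑ j, A i j = s i) ∧ ∀ j, ∑ i, A i j = t j) → f (monomial (X m n) A) = 0 := by
  constructor
  · intro hf A hA
    by_contra h
    refine hA ⟨?_, ?_⟩
    · by_contra hs
      have := weight_conv_monomial s f A
      rw [hf.1, if_neg fun e => hs (congrFun e)] at this
      exact h this
    · by_contra ht
      have := conv_weight_monomial f t A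
      rw [hf.2, if_neg fun e => ht (congrFun e)] at this
      exact h this
  · intro hf
    refine ⟨(basis m n).ext fun A => ?_, (basis m n).ext fun A => ?_⟩
    · rw [basis_apply, weight_conv_monomial]
      split_ifs with h
      · rfl
      · exact (hf A fun h' => h (funext h'.1)).symm
    · rw [basis_apply, conv_weight_monomial]
      split_ifs with h
      · rfl
      · exact (hf A fun h' => h (funext h'.2)).symm

theorem weight_mem_homSpace (s : Fin n → ℕ) : weight s ∈ homSpace s s := by
  refine mem_homSpace_iff.2 fun A hA => ?_
  rw [weight_eq_coord, coord_monomial, if_neg]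
  rintro rfl
  exact hA (by simp [Matrix.diagonal_apply])

theorem tensor_mem_homSpace {s : Fin a → ℕ} {t : Fin c → ℕ} {u : Fin b → ℕ} {v : Fin d → ℕ}
    {f : Module.Dual Zq (QMat a c)} {g : Module.Dual Zq (QMat b d)} (hf : f ∈ homSpace s t)
    (hg : g ∈ homSpace u v) : tensor f g ∈ homSpace (Fin.append s u) (Fin.append t v) :=
  ⟨by rw [← tensor_weight, conv_tensor, hf.1, hg.1],
    by rw [← tensor_weight, conv_tensor, hf.2, hg.2]⟩

theorem coord_mem_homSpace {lam mu : Comp} (A : Mat lam mu) :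
    (basis lam.len mu.len).coord A.1 ∈ homSpace lam.part mu.part := by
  refine mem_homSpace_iff.2 fun B hB => ?_
  rw [coord_monomial, if_neg]
  rintro rfl
  exact hB A.2

/-- A functional in `homSpace` is determined by its values at the monomials of matrices with
the given row and column sums. -/
noncomputable def homSpaceEquiv (lam mu : Comp) :
    homSpace lam.part mu.part ≃ₗ[Zq] (Mat lam mu → Zq) where
  toFun f A := f.1 (monomial (X _ _) A.1)
  map_add' _ _ := rfl
  map_smul' _ _ := rfl
  invFun c := ∑ A, c A • ⟨(basis _ _).coord A.1, coord_mem_homSpace A⟩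
  left_inv f := by
    refine Subtype.ext ((basis _ _).ext fun B => ?_)
    rw [basis_apply]
    simp only [Submodule.coe_sum, Submodule.coe_smul, LinearMap.sum_apply, LinearMap.smul_apply,
      coord_monomial]
    by_cases hB : (∀ i, ∑ j, B i j = lam.part i) ∧ ∀ j, ∑ i, B i j = mu.part j
    · rw [Finset.sum_eq_single ⟨B, hB⟩]
      · simp
      · intro A _ hA
        rw [if_neg fun e => hA (Subtype.ext e.symm), smul_zero]
      · exact fun h => absurd (Finset.mem_univ _) h
    · rw [mem_homSpace_iff.1 f.2 B hB]
      refine Finset.sum_eq_zero fun A _ => ?_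
      rw [if_neg, smul_zero]
      rintro rfl
      exact hB A.2
  right_inv c := by
    funext B
    simp only [Submodule.coe_sum, Submodule.coe_smul, LinearMap.sum_apply, LinearMap.smul_apply,
      coord_monomial]
    rw [Finset.sum_eq_single B]
    · simp
    · intro A _ hA
      rw [if_neg fun e => hA (Subtype.ext e.symm), smul_zero]
    · simp

/-- The basis of `homSpace` dual to the normally ordered monomials. -/
noncomputable def homBasis (lam mu : Comp) :
    Module.Basis (Mat lam mu) Zq (homSpace lam.part mu.part) :=
  Module.Basis.ofEquivFun (homSpaceEquiv lam mu)

theorem homBasis_repr (lam mu : Comp) (f : homSpace lam.part mu.part) (A : Mat lam mu) :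
    (homBasis lam mu).repr f A = f.1 (monomial (X _ _) A.1) :=
  rfl

open Classical in
theorem coe_homBasis (lam mu : Comp) (A : Mat lam mu) :
    (homBasis lam mu A).1 = (basis _ _).coord A.1 := by
  have h : homBasis lam mu A = ⟨(basis _ _).coord A.1, coord_mem_homSpace A⟩ := by
    refine (homBasis lam mu).repr.injective (Finsupp.ext fun B => ?_)
    rw [Module.Basis.repr_self, homBasis_repr, coord_monomial, Finsupp.single_apply]
    exact if_congr ⟨fun e => by rw [e], fun e => Subtype.ext e.symm⟩ rfl rfl
  rw [h]

end HomSpace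

/-! ### The category -/

/-- `f ≫ g` is the convolution of `g` with `f`, in this order, because rows belong to the target.
The identity laws are the two conditions defining `homSpace`. -/
noncomputable instance : Category.{0} Comp where
  Hom mu lam := homSpace lam.part mu.part
  id lam := ⟨QMat.weight lam.part, weight_mem_homSpace lam.part⟩
  comp f g := ⟨QMat.conv g.1 f.1, conv_mem_homSpace g.2 f.2⟩
  id_comp f := Subtype.ext f.2.2
  comp_id f := Subtype.ext f.2.1
  assoc f g h := Subtype.ext (QMat.conv_assoc h.1 g.1 f.1).symm

/-- The functional underlying a morphism. -/
noncomputable def toDual {mu lam : Comp} (f : mu ⟶ lam) :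
    Module.Dual Zq (QMat lam.len mu.len) :=
  Subtype.val (p := (· ∈ homSpace lam.part mu.part)) f

theorem toDual_injective {mu lam : Comp} :
    Function.Injective (toDual : (mu ⟶ lam) → _) :=
  Subtype.val_injective

theorem toDual_comp {nu mu lam : Comp} (f : nu ⟶ mu) (g : mu ⟶ lam) :
    toDual (f ≫ g) = QMat.conv (toDual g) (toDual f) :=
  rfl

theorem toDual_id (lam : Comp) : toDual (𝟙 lam) = QMat.weight lam.part :=
  rfl

noncomputable instance : Preadditive Comp where
  homGroup mu lam := inferInstanceAs (AddCommGroup (homSpace lam.part mu.part))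
  add_comp _ _ _ f f' g := Subtype.ext (QMat.conv_add g.1 f.1 f'.1)
  comp_add _ _ _ f g g' := Subtype.ext (QMat.add_conv g.1 g'.1 f.1)

noncomputable instance : Linear Zq Comp where
  homModule mu lam := inferInstanceAs (Module Zq (homSpace lam.part mu.part))
  smul_comp _ _ _ r f g := Subtype.ext (QMat.conv_smul r g.1 f.1)
  comp_smul _ _ _ f r g := Subtype.ext (QMat.smul_conv r g.1 f.1)

/-- The basis of the morphism space dual to the normally ordered monomials. -/
noncomputable def xi (lam mu : Comp) : Module.Basis (Mat lam mu) Zq (mu ⟶ lam) :=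
  homBasis lam mu

theorem toDual_xi (lam mu : Comp) (A : Mat lam mu) :
    toDual (xi lam mu A) = (QMat.basis _ _).coord A.1 :=
  coe_homBasis lam mu A

theorem xi_repr (lam mu : Comp) (f : mu ⟶ lam) (A : Mat lam mu) :
    (xi lam mu).repr f A = toDual f (monomial (QMat.X _ _) A.1) :=
  homBasis_repr lam mu f A

/-- Reduces naturality of the structure isomorphisms to a comparison of functionals through
`reindex`. -/
theorem comp_eqToHom_eq {mu mu' lam lam' : Comp} (hm : mu = mu') (hl : lam = lam')
    (f : mu ⟶ lam) (g : mu' ⟶ lam')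
    (h : ∀ y, toDual f y =
      toDual g (QMat.reindex (congrArg Comp.len hl) (congrArg Comp.len hm) y)) :
    f ≫ eqToHom hl = eqToHom hm ≫ g := by
  subst hm hl
  rw [eqToHom_refl, eqToHom_refl, Category.comp_id, Category.id_comp]
  refine toDual_injective (LinearMap.ext fun y => ?_)
  rw [h, QMat.reindex_rfl]
  rfl

namespace Comp

theorem eq_of_part {lam mu : Comp} (h : lam.len = mu.len)
    (h' : ∀ i, lam.part i = mu.part (Fin.cast h i)) : lam = mu := by
  obtain ⟨n, s⟩ := lam
  obtain ⟨m, t⟩ := mu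
  obtain rfl : n = m := h
  exact congrArg (Comp.mk n) (funext h')

theorem concat_assoc (lam mu nu : Comp) :
    (lam.concat mu).concat nu = lam.concat (mu.concat nu) :=
  eq_of_part (add_assoc _ _ _) fun i => congrFun (Fin.append_assoc lam.part mu.part nu.part) i

theorem empty_concat (lam : Comp) : empty.concat lam = lam :=
  eq_of_part (zero_add _) fun i => by
    induction i using Fin.addCases with
    | left i => exact i.elim0
    | right i =>
      exact (Fin.append_right empty.part lam.part i).trans
        (congrArg lam.part (Fin.ext (zero_add i.1).symm))

theorem concat_empty (lam : Comp) : lam.concat empty = lam :=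
  eq_of_part (add_zero _) fun i => by
    induction i using Fin.addCases with
    | left i => exact Fin.append_left _ _ i
    | right i => exact i.elim0

end Comp

/-- The tensor product of morphisms. -/
noncomputable def tensorMor {mu lam rho sig : Comp} (f : mu ⟶ lam) (g : rho ⟶ sig) :
    mu.concat rho ⟶ lam.concat sig :=
  (⟨QMat.tensor (toDual f) (toDual g), tensor_mem_homSpace f.2 g.2⟩ :
    homSpace (lam.concat sig).part (mu.concat rho).part)

noncomputable instance : MonoidalCategoryStruct Comp where
  tensorObj := Comp.concat
  whiskerLeft X _ _ f := tensorMor (𝟙 X) f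
  whiskerRight f X := tensorMor f (𝟙 X)
  tensorHom f g := tensorMor f g
  tensorUnit := Comp.empty
  associator X Y Z := eqToIso (Comp.concat_assoc X Y Z)
  leftUnitor X := eqToIso (Comp.empty_concat X)
  rightUnitor X := eqToIso (Comp.concat_empty X)

theorem toDual_tensorHom {mu lam rho sig : Comp} (f : mu ⟶ lam) (g : rho ⟶ sig) :
    toDual (f ⊗ₘ g) = QMat.tensor (toDual f) (toDual g) :=
  rfl

theorem id_tensor_id (X Y : Comp) : 𝟙 X ⊗ₘ 𝟙 Y = 𝟙 (X ⊗ Y) :=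
  toDual_injective (QMat.tensor_weight X.part Y.part)

theorem eqToHom_tensor_eqToHom {X X' Y Y' : Comp} (h : X = X') (h' : Y = Y') :
    eqToHom h ⊗ₘ eqToHom h' = eqToHom (congrArg₂ (· ⊗ ·) h h') := by
  subst h h'
  exact id_tensor_id X Y

theorem associator_hom (X Y Z : Comp) : (α_ X Y Z).hom = eqToHom (Comp.concat_assoc X Y Z) :=
  rfl

theorem leftUnitor_hom (X : Comp) : (λ_ X).hom = eqToHom (Comp.empty_concat X) :=
  rfl

theorem rightUnitor_hom (X : Comp) : (ρ_ X).hom = eqToHom (Comp.concat_empty X) :=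
  rfl

/-- All structure isomorphisms are `eqToHom`s, so pentagon and triangle compare two `eqToHom`s with
the same source and target. -/
noncomputable instance : MonoidalCategory Comp :=
  MonoidalCategory.ofTensorHom
    (id_tensorHom_id := id_tensor_id)
    (id_tensorHom := fun _ _ _ _ => rfl)
    (tensorHom_id := fun _ _ => rfl)
    (tensorHom_comp_tensorHom := fun f₁ f₂ g₁ g₂ =>
      toDual_injective (QMat.conv_tensor (toDual g₁) (toDual g₂) (toDual f₁) (toDual f₂)))
    (associator_naturality := fun f₁ f₂ f₃ =>
      comp_eqToHom_eq (Comp.concat_assoc _ _ _) (Comp.concat_assoc _ _ _) _ _ fun y =>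
        QMat.tensor_assoc (toDual f₁) (toDual f₂) (toDual f₃) y)
    (leftUnitor_naturality := fun f =>
      comp_eqToHom_eq (Comp.empty_concat _) (Comp.empty_concat _) _ _ fun y =>
        QMat.weight_tensor _ (toDual f) y)
    (rightUnitor_naturality := fun f =>
      comp_eqToHom_eq (Comp.concat_empty _) (Comp.concat_empty _) _ _ fun y =>
        QMat.tensor_weight_zero _ (toDual f) y)
    (pentagon := fun W X Y Z => by
      simp only [associator_hom, ← eqToHom_refl _ rfl, eqToHom_tensor_eqToHom, eqToHom_trans])
    (triangle := fun X Y => by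
      simp only [associator_hom, leftUnitor_hom, rightUnitor_hom, ← eqToHom_refl _ rfl,
        eqToHom_tensor_eqToHom, eqToHom_trans])

instance : MonoidalPreadditive Comp where
  whiskerLeft_zero {X _ _} := toDual_injective (by
    simpa using! QMat.tensor_smul 0 (toDual (𝟙 X)) 0)
  zero_whiskerRight {X _ _} := toDual_injective (by
    simpa using! QMat.smul_tensor 0 0 (toDual (𝟙 X)))
  whiskerLeft_add {X _ _} _ _ := toDual_injective (QMat.tensor_add (toDual (𝟙 X)) _ _)
  add_whiskerRight {X _ _} _ _ := toDual_injective (QMat.add_tensor _ _ (toDual (𝟙 X)))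

instance : MonoidalLinear Zq Comp where
  whiskerLeft_smul X _ _ r _ := toDual_injective (QMat.tensor_smul r (toDual (𝟙 X)) _)
  smul_whiskerRight r _ _ _ X := toDual_injective (QMat.smul_tensor r _ (toDual (𝟙 X)))

/-! ### The structure expressed in the basis `xi`. -/

theorem xi_tensor_xi {lam mu sig rho : Comp} (A : Mat lam mu) (B : Mat sig rho) :
    xi lam mu A ⊗ₘ xi sig rho B = xi (lam.concat sig) (mu.concat rho) (A.diag B) := by
  refine toDual_injective ?_
  rw [toDual_tensorHom, toDual_xi, toDual_xi]
  exact (QMat.tensor_coord A.1 B.1).trans (toDual_xi _ _ (A.diag B)).symm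

theorem id_eq_xi (lam : Comp) : 𝟙 lam = xi lam lam (Mat.diagonal lam) := by
  refine toDual_injective ?_
  rw [toDual_id, toDual_xi]
  exact QMat.weight_eq_coord lam.part

theorem sum_part_eq_of_mat {lam mu : Comp} (A : Mat lam mu) : lam.size = mu.size := by
  unfold Comp.size
  rw [← Finset.sum_congr rfl fun i _ => A.2.1 i, ← Finset.sum_congr rfl fun j _ => A.2.2 j,
    Finset.sum_comm]

theorem eq_zero_of_size_ne {lam mu : Comp} (h : lam.size ≠ mu.size) (f : mu ⟶ lam) : f = 0 := by
  have : IsEmpty (Mat lam mu) := ⟨fun A => h (sum_part_eq_of_mat A)⟩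
  exact (xi lam mu).ext_elem fun A => isEmptyElim A

/-! ### Square matrices -/

namespace Oq

variable {n : ℕ}

theorem isManin_gen (n : ℕ) : IsManin (Matrix.of fun i j : Fin n => gen i j) where
  comm h h' := gen_comm h h'
  cross h h' := gen_cross h h'
  row i _ _ h' := gen_row i h'
  col j h := gen_col j h

/-- The algebra homomorphism to `QMat n n` matching the generators. -/
noncomputable def toQMat (n : ℕ) : Oq n →ₐ[Zq] QMat n n :=
  RingQuot.liftAlgHom Zq
    ⟨FreeAlgebra.lift Zq (fun p : Fin n × Fin n => QMat.X n n p.1 p.2), by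
      intro x y hxy
      cases hxy with
      | comm i j k l h h' => simpa using (QMat.isManin_X n n).comm h h'
      | cross i j k l h h' => simpa using (QMat.isManin_X n n).cross h h'
      | row i j l h' => simpa using (QMat.isManin_X n n).row i h'
      | col i j k h => simpa using (QMat.isManin_X n n).col j h⟩

theorem toQMat_gen (i j : Fin n) : toQMat n (gen i j) = QMat.X n n i j := by
  refine (RingQuot.liftAlgHom_mkAlgHom_apply _ _ _ _).trans ?_
  simp only [FreeAlgebra.lift_ι_apply]

/-- The square case of `QMat` is `O_q(n)`. -/
noncomputable def equivQMat (n : ℕ) : QMat n n ≃ₐ[Zq] Oq n :=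
  AlgEquiv.ofAlgHom (QMat.lift _ (isManin_gen n)) (toQMat n)
    (by
      refine RingQuot.ringQuot_ext' _ _ _ (FreeAlgebra.hom_ext ?_)
      funext p
      change QMat.lift _ (isManin_gen n) (toQMat n (gen p.1 p.2)) = gen p.1 p.2
      rw [toQMat_gen, QMat.lift_X, Matrix.of_apply])
    (QMat.hom_ext fun i j => by
      rw [AlgHom.comp_apply, QMat.lift_X, Matrix.of_apply, toQMat_gen, AlgHom.id_apply])

theorem equivQMat_X (i j : Fin n) : equivQMat n (QMat.X n n i j) = gen i j :=
  QMat.lift_X _ _ i j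

/-- The basis of normally ordered monomials. -/
noncomputable def basis (n : ℕ) : Module.Basis (Matrix (Fin n) (Fin n) ℕ) Zq (Oq n) :=
  (QMat.basis n n).map (equivQMat n).toLinearEquiv

theorem equivQMat_monomial (A : Matrix (Fin n) (Fin n) ℕ) :
    equivQMat n (monomial (QMat.X n n) A) = normalMonomial A :=
  QMat.lift_monomial _ (isManin_gen n) A

theorem basis_apply (A : Matrix (Fin n) (Fin n) ℕ) : basis n A = normalMonomial A := by
  rw [← equivQMat_monomial, basis, Module.Basis.map_apply, QMat.basis_apply]
  rfl

theorem coord_basis (A : Matrix (Fin n) (Fin n) ℕ) :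
    (basis n).coord A = (QMat.basis n n).coord A ∘ₗ (toQMat n).toLinearMap :=
  rfl

theorem toQMat_comul (n : ℕ) :
    (Algebra.TensorProduct.map (toQMat n) (toQMat n)).comp
      ((comul n).comp (equivQMat n).toAlgHom) = QMat.comul n n n := by
  refine QMat.hom_ext fun i k => ?_
  rw [QMat.comul_X, AlgHom.comp_apply, AlgHom.comp_apply]
  change Algebra.TensorProduct.map (toQMat n) (toQMat n)
    (comul n (equivQMat n (QMat.X n n i k))) = _
  rw [equivQMat_X, comul_gen, map_sum]
  simp only [Algebra.TensorProduct.map_tmul, toQMat_gen]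

/-- Through the isomorphism with `QMat n n`, the structure constant is the value at `x_C` of the
convolution of two coordinate functions. -/
theorem structConst_basis (A B C : Matrix (Fin n) (Fin n) ℕ) :
    structConst (basis n) A B C =
      QMat.conv ((QMat.basis n n).coord A) ((QMat.basis n n).coord B)
        (monomial (QMat.X n n) C) := by
  rw [structConst, coord_basis, coord_basis, dualDistrib_comp, QMat.conv_apply, ← toQMat_comul,
    basis_apply, ← equivQMat_monomial]
  rfl

end Oq

/-- The coefficient at `C` is the value of the convolution at `x_C`, which padding does not change.
-/
theorem xi_comp_xi {lam mu nu : Comp} (A : Mat lam mu) (B : Mat mu nu) (n : ℕ)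
    (f : Fin lam.len ↪o Fin n) (g : Fin mu.len ↪o Fin n) (h : Fin nu.len ↪o Fin n) :
    xi mu nu B ≫ xi lam mu A =
      ∑ C : Mat lam nu,
        structConst (Oq.basis n) (A.pad f g) (B.pad g h) (C.pad f h) • xi lam nu C := by
  rw [← (xi lam nu).sum_repr (xi mu nu B ≫ xi lam mu A)]
  refine Finset.sum_congr rfl fun C _ => ?_
  rw [xi_repr, toDual_comp, toDual_xi, toDual_xi, Oq.structConst_basis]
  congr 1
  exact (QMat.conv_coord_zeroExtend f g h A.1 B.1 C.1).symm

end QSchur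

theorem mainTheorem9 :
    -- the normally ordered monomials form a basis of each `O_q(n)`
    ∃ (x : ∀ n : ℕ, Module.Basis (Matrix (Fin n) (Fin n) ℕ) QSchur.Zq (QSchur.Oq n)),
      (∀ (n : ℕ) (A : Matrix (Fin n) (Fin n) ℕ), x n A = QSchur.normalMonomial A) ∧
    -- a `ℤ[q, q⁻¹]`-linear monoidal category whose objects are all compositions
    ∃ (_ : Category.{0} QSchur.Comp) (_ : Preadditive QSchur.Comp)
      (_ : Linear QSchur.Zq QSchur.Comp) (_ : MonoidalCategory QSchur.Comp)
      (_ : MonoidalPreadditive QSchur.Comp) (_ : MonoidalLinear QSchur.Zq QSchur.Comp)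
      -- the basis `ξ_A` of `Hom(μ, λ)`, for `A` in `Mat(λ, μ)`
      (ξ : ∀ lam mu : QSchur.Comp, Module.Basis (QSchur.Mat lam mu) QSchur.Zq (mu ⟶ lam))
      -- tensor product of objects is concatenation
      (tensor_eq : ∀ lam mu : QSchur.Comp, lam ⊗ mu = lam.concat mu),
      -- the unit object is the empty composition, and the monoidal category is strict
      𝟙_ QSchur.Comp = QSchur.Comp.empty ∧
      (∀ lam mu nu : QSchur.Comp, ∃ h : (lam ⊗ mu) ⊗ nu = lam ⊗ (mu ⊗ nu),
        (α_ lam mu nu).hom = eqToHom h) ∧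
      (∀ lam : QSchur.Comp, ∃ h : 𝟙_ QSchur.Comp ⊗ lam = lam, (λ_ lam).hom = eqToHom h) ∧
      (∀ lam : QSchur.Comp, ∃ h : lam ⊗ 𝟙_ QSchur.Comp = lam, (ρ_ lam).hom = eqToHom h) ∧
      -- morphism spaces between compositions of different sizes are zero
      (∀ lam mu : QSchur.Comp, lam.size ≠ mu.size → ∀ φ : mu ⟶ lam, φ = 0) ∧
      -- identity morphisms
      (∀ lam : QSchur.Comp, 𝟙 lam = ξ lam lam (QSchur.Mat.diagonal lam)) ∧
      -- tensor product of morphisms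
      (∀ (lam mu sig rho : QSchur.Comp) (A : QSchur.Mat lam mu) (B : QSchur.Mat sig rho),
        ξ lam mu A ⊗ₘ ξ sig rho B =
          eqToHom (tensor_eq mu rho) ≫ ξ (lam.concat sig) (mu.concat rho) (A.diag B) ≫
            eqToHom (tensor_eq lam sig).symm) ∧
      -- vertical composition `ξ_A ∘ ξ_B = ∑_C Z(A, B, C) ξ_C`, where `Z(A, B, C)` is computed
      -- in `O_q(n)` after any insertion of zeros that makes the three compositions of length `n`
      (∀ (lam mu nu : QSchur.Comp) (A : QSchur.Mat lam mu) (B : QSchur.Mat mu nu) (n : ℕ)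
        (f : Fin lam.len ↪o Fin n) (g : Fin mu.len ↪o Fin n) (h : Fin nu.len ↪o Fin n),
        ξ mu nu B ≫ ξ lam mu A =
          ∑ C : QSchur.Mat lam nu,
            QSchur.structConst (x n) (A.pad f g) (B.pad g h) (C.pad f h) • ξ lam nu C) := by
  refine ⟨QSchur.Oq.basis, fun n A => QSchur.Oq.basis_apply A, inferInstance, inferInstance,
    inferInstance, inferInstance, inferInstance, inferInstance, QSchur.xi, fun _ _ => rfl, rfl,
    fun lam mu nu => ⟨QSchur.Comp.concat_assoc lam mu nu, rfl⟩,
    fun lam => ⟨QSchur.Comp.empty_concat lam, rfl⟩,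
    fun lam => ⟨QSchur.Comp.concat_empty lam, rfl⟩,
    fun lam mu h φ => QSchur.eq_zero_of_size_ne h φ, QSchur.id_eq_xi, ?_,
    fun lam mu nu A B n f g h => QSchur.xi_comp_xi A B n f g h⟩
  intro lam mu sig rho A B
  -- The tensor product of objects is concatenation by definition, so both transports are
  -- identities.
  rw [QSchur.xi_tensor_xi, eqToHom_refl, eqToHom_refl]
  exact ((Category.id_comp _).trans (Category.comp_id _)).symm
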